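/- **Setting.** Let $\mathbf I$ be a finite index set. A configuration $X=(X^i)_{i\in\mathbf I}$ consists of locally finite sets $X^i\subset\mathbb R$ (the points of component $i$) that are pairwise disjoint; $\mathcal X$ is the set of configurations all of whose points lie in $(-\infty,0)$. Configurations carry the $\sigma$-algebra generated by the numbers of points in bounded intervals. For a configuration $X$ and $t\in\mathbb R$, let $X_t^{\leftarrow t}\in\mathcal X$ be the configuration with the points $s-t$, for the points $s<t$ of $X$. For each $i$ let $\mathbf V^i$ be a countable family of finite neighborhoods, i.e. of Borel sets $v\subset\mathbf I\times(-\infty,0)$ contained in $J\times[a,b]$ with $J$ finite and $[a,b]$ a bounded interval. Let $\mathcal Y\subset\mathcal X$, let $\phi^i:\mathcal X\to[0,\infty)$ be measurable, and for $v\in\mathbf V^i$ let $\Delta^i_v:\mathcal X\to[0,\infty)$ be measurable and cylindrical in $v$ (that is, $\Delta^i_v(x)$ depends only on the points of $x$ in $v$), such that for all $x\in\mathcal Y$ the sum $\sum_{v\in\mathbf V^i}\Delta^i_v(x)$ converges and equals $\phi^i(x)$. Let $\lambda^i$ be probabilities on $\mathbf V^i$ such that $\lambda^i(v)=0$ only if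 $\Delta^i_v=0$ on $\mathcal Y$, and put $\phi^i_v=\Delta^i_v/\lambda^i(v)$ (and $\phi^i_v=0$ if $\lambda^i(v)=0$). Assume that the intensities do not increase in the absence of further points: $\phi^i_v(x_t^{\leftarrow t})\le\phi^i_v(x)$ for all $i$, $v\in\mathbf V^i$, $t\ge0$ and $x\in\mathcal X$ (no points are added in $[-t,0)$). Fix $t_{max}>0$ and $N_{max}\in\mathbb N$. For a configuration $X$ let $\tau=\tau(X)=t_{max}\wedge\inf\{t\ge0: X_t^{\leftarrow t}\notin\mathcal Y\}$; assume that $\tau$ is a measurable function of $X$. **Algorithm.** Start with no points, $X=\mathbf 0$, and $T=N=0$. While $T\le\tau(X)$ and $N\le N_{max}$: 1. For each $i$ compute a bound $\tilde\Gamma^i=\tilde\Gamma^i(X,T)\in[0,\infty)$, where $\tilde\Gamma^i$ is a measurable function of the points $X$ accepted so far and of $T$. It is required that, if $0\le T<\tau(X)$ and all the points of $X$ lie in $(0,T]$, then $\tilde\Gamma^i(X,T)\ge\sup_{v\in\mathbf V^i}\phi^i_v(X^{\leftarrow T})$, where $X^{\leftarrow T}$ includes a point accepted at $T$ itself, that is,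 $\phi^i_v(X^{\leftarrow T})$ stands for $\lim_{s\downarrow T}\phi^i_v(X_s^{\leftarrow s})$. 2. Replace $T$ by $T+\mathrm{Exp}(\sum_i\tilde\Gamma^i)$ (by $\infty$ if $\sum_i\tilde\Gamma^i=0$). If $T>\tau(X)$, stop; otherwise choose an index $i$ with probability $\tilde\Gamma^i/\sum_j\tilde\Gamma^j$. 3. Choose $v\in\mathbf V^i$ with probability $\lambda^i(v)$. 4. With probability $\phi^i_v(X_T^{\leftarrow T})/\tilde\Gamma^i$ accept $T$ and add it to $X^i$; otherwise reject it. In both cases replace $N$ by $N+1$. **Claim.** The Kalikow decomposition $\phi^i(x)=\sum_{v\in\mathbf V^i}\lambda^i(v)\phi^i_v(x)$ holds for all $i$ and $x\in\mathcal Y$. The algorithm ends almost surely, after at most $N_{max}+1$ runs of the loop, and it simulates, starting from the empty past before time $0$, a time homogeneous counting process with generic intensities $\phi^i$ up to the time $H=\tau(X)\wedge T$, where $X$, $T$ are the final values (so $H=\tau$ if the algorithm stopped because of $T>\tau$, and $H$ is the last proposed time if it stopped because of $N>N_{max}$). Precisely: almost surely all points of $X$ lie in $(0,H]$ and $\int_0^H\phi^i(X_s^{\leftarrow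 s})\,ds<\infty$ for all $i$; and, with $\mathcal F_t$ the $\sigma$-algebra generated by the numbers of points of the components of $X$ in $(0,s]$ and by the events $\{H\le s\}$, for $s\le t$, one has for all $i$, all $0\le a\le b$ and all $A\in\mathcal F_a$ $$\mathbb E\big[\mathbf 1_A\,\#\big(X^i\cap(a,b]\cap(-\infty,H]\big)\big]=\mathbb E\Big[\mathbf 1_A\int_a^b\mathbf 1_{\{s\le H\}}\,\phi^i(X_s^{\leftarrow s})\,ds\Big].$$ That is, $\phi^i(X_s^{\leftarrow s})\mathbf 1_{\{s\le H\}}$ is the stochastic intensity of component $i$ of the process stopped at $H$. -/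

import Mathlib

open MeasureTheory ProbabilityTheory Set Filter Topology
open scoped NNReal ENNReal

namespace KalikowForward

noncomputable section

/-- A configuration of points of a simple, locally finite counting process with components indexed
by `I`: for each `i` the (finite or infinite) set of points of component `i`, locally finite on the
real line, such that two different components have no point in common. -/
@[ext] structure Config (I : Type*) where
  pts : I → Set ℝ
  locFinite : ∀ i a b, (pts i ∩ Icc a b).Finite
  disj : ∀ i j, i ≠ j → Disjoint (pts i) (pts j)

/-- The number of points of component `i` in the set `B` (used for bounded `B` only). -/
def Config.count {I : Type*} (x : Config I) (i : I) (B : Set ℝ) : ℕ := (x.pts i ∩ B).ncard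

/-- The sigma-algebra generated by the numbers of points in bounded intervals, that is, the product
of the Borel sigma-algebras of the vague topologies. -/
instance {I : Type*} : MeasurableSpace (Config I) :=
  ⨆ (i : I) (a : ℝ) (b : ℝ), MeasurableSpace.comap (fun x => x.count i (Ico a b)) ⊤

/-- The configurations all of whose points are strictly before time `0`. -/
def PastConfig (I : Type*) : Type _ := {x : Config I // ∀ i, x.pts i ⊆ Iio 0}

instance {I : Type*} : MeasurableSpace (PastConfig I) :=
  inferInstanceAs (MeasurableSpace {x : Config I // ∀ i, x.pts i ⊆ Iio 0})

/-- The configuration without points. -/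
def Config.empty (I : Type*) : Config I where
  pts _ := ∅
  locFinite := by simp
  disj := by simp

/-- The past of `x` strictly before time `t`, shifted to be rooted at time `0`: the points `s - t`
for the points `s < t` of `x`. -/
def Config.past {I : Type*} (x : Config I) (t : ℝ) : PastConfig I :=
  ⟨{ pts := fun i => {u | u < 0 ∧ u + t ∈ x.pts i}
     locFinite := fun i a b => by
       refine ((x.locFinite i (a + t) (b + t)).preimage
         ((add_left_injective t).injOn (s := _))).subset ?_
       rintro u ⟨⟨-, hu⟩, hua, hub⟩
       exact ⟨hu, by linarith, by linarith⟩
     disj := fun i j hij => by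
       rw [Set.disjoint_left]
       rintro u ⟨-, hi⟩ ⟨-, hj⟩
       exact Set.disjoint_left.1 (x.disj i j hij) hi hj },
   fun _ _ hu => hu.1⟩

/-- For a configuration `x` before time `0` and `t ≥ 0`: all the points of `x` are shifted to the
left by `t`, and no points are added in `[-t, 0)`. -/
def PastConfig.shift {I : Type*} (x : PastConfig I) (t : ℝ) : PastConfig I := x.1.past t

/-- `x` with the point `t` added to component `i`. (If `t` is already a point of some component,
which has probability zero in the algorithm, nothing is added.) -/
def Config.insert {I : Type*} (x : Config I) (i : I) (t : ℝ) : Config I where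
  pts j := {s | s ∈ x.pts j ∨ (j = i ∧ s = t ∧ ∀ k, t ∉ x.pts k)}
  locFinite j a b := by
    refine ((x.locFinite j a b).union (Set.finite_singleton t)).subset ?_
    rintro s ⟨hs | ⟨-, hs, -⟩, hab⟩
    · exact Or.inl ⟨hs, hab⟩
    · exact Or.inr hs
  disj j k hjk := by
    rw [Set.disjoint_left]
    rintro s (hj | ⟨rfl, rfl, hj⟩) (hk | ⟨rfl, hs, hk⟩)
    · exact Set.disjoint_left.1 (x.disj j k hjk) hj hk
    · exact hk j (hs ▸ hj)
    · exact hj k hk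
    · exact hjk rfl

/-- A finite neighborhood: a Borel subset of `I × (-∞, 0)` (with `I` discrete) that is contained in
`J × [a, b]` for a finite set `J` and a bounded interval `[a, b]`. -/
structure IsFiniteNeighborhood {I : Type*} (v : Set (I × ℝ)) : Prop where
  borel : ∀ i, MeasurableSet {s | (i, s) ∈ v}
  neg : ∀ p ∈ v, p.2 < 0
  finite : ∃ J : Set I, J.Finite ∧ ∃ a b : ℝ, v ⊆ J ×ˢ Icc a b

/-- `x` and `y` have the same points in `v`. -/
def AgreeOn {I : Type*} (v : Set (I × ℝ)) (x y : PastConfig I) : Prop :=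
  ∀ i s, (i, s) ∈ v → (s ∈ x.1.pts i ↔ s ∈ y.1.pts i)

/-- `f` is cylindrical in `v`. -/
def IsCylindrical {I : Type*} (v : Set (I × ℝ)) (f : PastConfig I → ℝ≥0) : Prop :=
  ∀ x y, AgreeOn v x y → f x = f y

/-- The cylindrical functions `φ^i_v = Δ^i_v / λ^i(v)` of the Kalikow decomposition, with the
convention `0 / 0 = 0`. -/
def kalikow {I : Type*} {V : I → Set (Set (I × ℝ))}
    (lam : ∀ i, PMF (V i)) (Δ : ∀ i, V i → PastConfig I → ℝ≥0)
    (i : I) (v : V i) (x : PastConfig I) : ℝ≥0 :=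
  Δ i v x / (lam i v).toNNReal

/-- `τ = tmax ∧ inf {t ≥ 0 : the past of x before t, rooted at 0, is not in Y}` (for `tmax ≥ 0`).
The infimum of the empty set is `∞` here, so that `τ = tmax` if there is no exit from `Y`. -/
def exitTime {I : Type*} (Y : Set (PastConfig I)) (tmax : ℝ) (x : Config I) : ℝ :=
  sInf ({t | 0 ≤ t ∧ x.past t ∉ Y} ∪ {tmax})

/-- The state of the algorithm: the points `X` accepted so far, the current time `T` (which may
become `∞`, if the total rate is zero), and the number `N` of simulation steps done so far. -/
abbrev State (I : Type*) : Type _ := Config I × ℝ≥0∞ × ℕ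

/-- The points accepted so far. -/
def State.X {I : Type*} (s : State I) : Config I := s.1

/-- The current time. -/
def State.T {I : Type*} (s : State I) : ℝ≥0∞ := s.2.1

/-- The number of simulation steps. -/
def State.N {I : Type*} (s : State I) : ℕ := s.2.2

section Algorithm

variable {I : Type*} [Fintype I] {V : I → Set (Set (I × ℝ))}

/-- Choice of the index and Steps 3 and 4, for a proposed point `t`, if the points accepted so far
are `x` and the current bounds are `g`: the index `i` is chosen with probability `g i / ∑ j, g j`,
the neighborhood `v` with probability `lam i v`, and `t` is accepted as a point of component `i`
with probability `φ^i_v (past of x before t) / g i`. This is the law of the new set of points. -/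
def thinning (lam : ∀ i, PMF (V i)) (φv : ∀ i, V i → PastConfig I → ℝ≥0)
    (g : I → ℝ≥0) (x : Config I) (t : ℝ) : Measure (Config I) :=
  ∑ i, ((g i / ∑ j, g j : ℝ≥0) : ℝ≥0∞) • Measure.sum fun v : V i => lam i v •
    (((min 1 (φv i v (x.past t) / g i) : ℝ≥0) : ℝ≥0∞) • Measure.dirac (x.insert i t) +
      ((1 - min 1 (φv i v (x.past t) / g i) : ℝ≥0) : ℝ≥0∞) • Measure.dirac x)

/-- The law of the next time `T + Exp(r)`; it is `∞` if the rate `r` is zero. -/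
def nextTimeLaw (T : ℝ≥0∞) (r : ℝ≥0) : Measure ℝ≥0∞ :=
  if r = 0 then Measure.dirac ∞ else (expMeasure (r : ℝ)).map fun e => T + ENNReal.ofReal e

open Classical in
/-- The law of the state after one run of the body of the loop
`While T ≤ τ and N ≤ Nmax do Step 1, ..., Step 4`, started in the state `s`; nothing happens if the
condition of the loop is violated. The function `Γ` is the rule that computes the bounds from the
points accepted so far and the current time. -/
def step (lam : ∀ i, PMF (V i)) (φv : ∀ i, V i → PastConfig I → ℝ≥0)
    (Γ : I → Config I → ℝ → ℝ≥0) (Y : Set (PastConfig I)) (tmax : ℝ) (Nmax : ℕ)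
    (s : State I) : Measure (State I) :=
  if s.T ≤ ENNReal.ofReal (exitTime Y tmax s.X) ∧ s.N ≤ Nmax then
    (nextTimeLaw s.T (∑ i, Γ i s.X s.T.toReal)).bind fun T' =>
      if ENNReal.ofReal (exitTime Y tmax s.X) < T' then
        Measure.dirac (s.X, T', s.N)
      else
        (thinning lam φv (fun i => Γ i s.X s.T.toReal) s.X T'.toReal).map
          fun x => (x, T', s.N + 1)
  else Measure.dirac s

/-- The law of the state after `n` runs of the body of the loop, started without points at time
`0`. -/
def stateLaw (lam : ∀ i, PMF (V i)) (φv : ∀ i, V i → PastConfig I → ℝ≥0)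
    (Γ : I → Config I → ℝ → ℝ≥0) (Y : Set (PastConfig I)) (tmax : ℝ) (Nmax : ℕ) :
    ℕ → Measure (State I)
  | 0 => Measure.dirac (Config.empty I, 0, 0)
  | n + 1 => (stateLaw lam φv Γ Y tmax Nmax n).bind (step lam φv Γ Y tmax Nmax)

/-- The law of the final state of the algorithm. Each run of the body of the loop either increases
`N` by one or makes `T > τ`; since the loop requires `N ≤ Nmax` and `N = 0` at the beginning, the
loop has ended after `Nmax + 1` runs. -/
def outputLaw (lam : ∀ i, PMF (V i)) (φv : ∀ i, V i → PastConfig I → ℝ≥0)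
    (Γ : I → Config I → ℝ → ℝ≥0) (Y : Set (PastConfig I)) (tmax : ℝ) (Nmax : ℕ) :
    Measure (State I) :=
  stateLaw lam φv Γ Y tmax Nmax (Nmax + 1)

end Algorithm

/-- The time up to which the process has been simulated, `τ ∧ T`: it is `τ` if the algorithm has
stopped because of `T > τ`, and the last proposed time if it has stopped because of `N > Nmax`. -/
def State.horizon {I : Type*} (Y : Set (PastConfig I)) (tmax : ℝ) (s : State I) : ℝ :=
  (min (ENNReal.ofReal (exitTime Y tmax s.X)) s.T).toReal

/-- The history at time `t` of a counting process with points `X` in `(0, ∞)` that is observed up to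
the random time `H`: generated by the numbers of points in `(0, s]` of all components and by the
events `H ≤ s`, for `s ≤ t`. -/
abbrev history {Ω I : Type*} (X : Ω → Config I) (H : Ω → ℝ) (t : ℝ) : MeasurableSpace Ω :=
  (⨆ (j : I) (s : ℝ) (_ : s ≤ t), MeasurableSpace.comap (fun ω => (X ω).count j (Ioc 0 s)) ⊤) ⊔
    MeasurableSpace.generateFrom {A | ∃ s ≤ t, A = {ω | H ω ≤ s}}

/-- The counting process with points `X`, observed on `[0, H]`, starts with empty past before time
`0`, and up to time `H` it is time homogeneous with generic intensities `φ i`: for every `i`, the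
process `φ i (X_s^{← s}) 1_{s ≤ H}` is a stochastic intensity of the process stopped at `H`, with
respect to the history, that is,
`E[1_A Z^i((a ∧ H, b ∧ H])] = E[1_A ∫ 1_{a < s ≤ b, s ≤ H} φ i (X_s^{← s}) ds]`
for all `0 ≤ a ≤ b` and all events `A` of the history at time `a`. -/
structure HasGenericIntensityUpTo {Ω I : Type*} [MeasurableSpace Ω] (P : Measure Ω)
    (X : Ω → Config I) (H : Ω → ℝ) (φ : I → PastConfig I → ℝ≥0) : Prop where
  measurable_points : Measurable X
  measurable_horizon : Measurable H
  points_mem : ∀ᵐ ω ∂P, ∀ i, (X ω).pts i ⊆ Ioc 0 (H ω)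
  integrable : ∀ᵐ ω ∂P, ∀ i, ∫⁻ s in Ioc 0 (H ω), (φ i ((X ω).past s) : ℝ≥0∞) < ∞
  intensity : ∀ (i : I) (a b : ℝ), 0 ≤ a → a ≤ b → ∀ A, MeasurableSet[history X H a] A →
    ∫⁻ ω in A, ((X ω).count i (Ioc a b ∩ Iic (H ω)) : ℝ≥0∞) ∂P =
      ∫⁻ ω in A, (∫⁻ s in Ioc a b ∩ Iic (H ω), (φ i ((X ω).past s) : ℝ≥0∞)) ∂P

end

end KalikowForward

/-!
The algorithm is a Markov chain on states `(X, T, N)`, and the intensity identity is proved for the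
law of its state after `n` runs of the loop, by induction on `n`.

Three facts are invariants of the chain (`State.Valid`): the points lie in `(0, H]`, the
compensators are finite, and the number of proposals equals the number of runs as long as the exit
time `τ` has not been passed. The last one shows that the loop has ended after `Nmax + 1` runs. The
bounds `Γ` computed at time `T` dominate every `φ^i_v` along the path until the next point is added,
because the `φ^i_v` do not increase while no points are added (`kalikow_past_le`). Hence no
acceptance probability is truncated, a proposal at time `t < τ` becomes a point of component `i`
with probability `φ i (X_t^{← t}) / r`, where `r = ∑ Γ^i` (`Admissible.acceptance_probability`), and
`φ i` is bounded by `Γ^i` between two proposals, so that the compensators stay finite.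

Let one run start at time `T` and propose the time `T + e`, and let `ψ` be `φ i (X_u^{← u})`,
restricted to `u ∈ (a, b]` and `u ≤ τ`. The run adds `ψ (T + e) / r` to the conditional mean number
of points, and `∫_T^{T + e} ψ` to the compensator. For an exponential `e` of rate `r` these have the
same mean, by Tonelli's theorem (`lintegral_exp_density_mul_lintegral`). An event `A` of the history
at time `a` is harmless: points and compensator in `(a, b]` only change in states whose horizon is
beyond `a`, and on all the states with horizon beyond `a` that arise from one state in one run, `A`
is decided by the points up to `a`, hence constant (`State.indicator_history_eq`). Thus a run
changes both sides of the identity by the same amount (`Admissible.exists_step_increment`).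

The laws of the algorithm are iterated binds, so that all of this needs the joint measurability of
pasts and insertions in the configuration and in time, which comes from that of the counts of points
in intervals with varying end points (`Config.measurable_count_Ico`).
-/

namespace KalikowForward

/-! ### Measurability of the operations on configurations -/

/-- Counts of points are continuous along sequences of bounded sets that converge pointwise: by
local finiteness only finitely many points matter. -/
theorem Config.eventually_count_eq {I : Type*} (x : Config I) (i : I) {B : ℕ → Set ℝ}
    {B₀ : Set ℝ} (c d : ℝ) (hB : ∀ᶠ n in atTop, B n ⊆ Icc c d) (h₀ : B₀ ⊆ Icc c d)
    (h : ∀ p, ∀ᶠ n in atTop, p ∈ B n ↔ p ∈ B₀) :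
    ∀ᶠ n in atTop, x.count i (B n) = x.count i B₀ := by
  have h1 : ∀ᶠ n in atTop, ∀ p ∈ x.pts i ∩ Icc c d, (p ∈ B n ↔ p ∈ B₀) :=
    (eventually_all_finite (x.locFinite i c d)).2 fun p _ => h p
  filter_upwards [hB, h1] with n hn1 hn2
  unfold Config.count
  congr 1
  ext p
  constructor
  · rintro ⟨hp, hpB⟩
    exact ⟨hp, (hn2 p ⟨hp, hn1 hpB⟩).1 hpB⟩
  · rintro ⟨hp, hpB⟩
    exact ⟨hp, (hn2 p ⟨hp, h₀ hpB⟩).2 hpB⟩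

theorem measurable_of_eventually_eq {α : Type*} [MeasurableSpace α] {f : ℕ → α → ℕ} {g : α → ℕ}
    (hf : ∀ n, Measurable (f n)) (h : ∀ x, ∀ᶠ n in atTop, f n x = g x) : Measurable g := by
  refine measurable_of_tendsto_metrizable hf (tendsto_pi_nhds.2 fun x => ?_)
  exact tendsto_nhds_of_eventually_eq (h x)

theorem Config.measurable_count_Ico_const {I : Type*} (i : I) (a b : ℝ) :
    Measurable fun x : Config I => x.count i (Ico a b) := by
  rw [measurable_iff_comap_le]
  exact le_iSup_of_le i (le_iSup_of_le a (le_iSup_of_le b le_rfl))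

theorem Config.measurable_of_count {I α : Type*} [MeasurableSpace α] {f : α → Config I}
    (h : ∀ i a b, Measurable fun ω => (f ω).count i (Ico a b)) : Measurable f := by
  rw [measurable_iff_comap_le]
  simp only [instMeasurableSpaceConfig, MeasurableSpace.comap_iSup, MeasurableSpace.comap_comp,
    iSup_le_iff]
  exact fun i a b => measurable_iff_comap_le.1 (h i a b)

theorem tendsto_add_one_div_nat (s : ℝ) :
    Tendsto (fun n : ℕ => s + 1 / ((n : ℝ) + 1)) atTop (𝓝 s) := by
  simpa using (tendsto_one_div_add_atTop_nhds_zero_nat (𝕜 := ℝ)).const_add s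

theorem tendsto_floor_mul_div (s : ℝ) :
    Tendsto (fun n : ℕ => (⌊s * ((n : ℝ) + 1)⌋ : ℝ) / ((n : ℝ) + 1)) atTop (𝓝 s) := by
  have h := (tendsto_one_div_add_atTop_nhds_zero_nat (𝕜 := ℝ)).const_sub s
  rw [sub_zero] at h
  refine tendsto_of_tendsto_of_tendsto_of_le_of_le h tendsto_const_nhds (fun n => ?_) fun n => ?_
  · have hn : (0 : ℝ) < (n : ℝ) + 1 := by positivity
    simp only [le_div_iff₀ hn, sub_mul, one_div, inv_mul_cancel₀ hn.ne']
    linarith [Int.lt_floor_add_one (s * ((n : ℝ) + 1))]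
  · have hn : (0 : ℝ) < (n : ℝ) + 1 := by positivity
    simp only [div_le_iff₀ hn]
    exact Int.floor_le _

/-- The number of points in `[s, u)` is jointly measurable in the configuration and the end points:
by left continuity in `s` and `u`, it is a limit of counts with end points on a grid. -/
theorem Config.measurable_count_Ico {I α : Type*} [MeasurableSpace α] (i : I) {f : α → Config I}
    {s u : α → ℝ} (hf : Measurable f) (hs : Measurable s) (hu : Measurable u) :
    Measurable fun ω => (f ω).count i (Ico (s ω) (u ω)) := by
  -- Rounding down to a fine grid adds no points of the locally finite set to `[s, u)` and removes
  -- none, and there are only countably many pairs of grid points.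
  have key : ∀ n : ℕ, Measurable fun ω => (f ω).count i
      (Ico ((⌊s ω * ((n : ℝ) + 1)⌋ : ℝ) / ((n : ℝ) + 1))
        ((⌊u ω * ((n : ℝ) + 1)⌋ : ℝ) / ((n : ℝ) + 1))) := by
    intro n
    have h1 : Measurable fun p : Config I × ℤ × ℤ => p.1.count i
        (Ico ((p.2.1 : ℝ) / ((n : ℝ) + 1)) ((p.2.2 : ℝ) / ((n : ℝ) + 1))) :=
      measurable_from_prod_countable_left fun q => Config.measurable_count_Ico_const i
        ((q.1 : ℝ) / ((n : ℝ) + 1)) ((q.2 : ℝ) / ((n : ℝ) + 1))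
    have h2 : Measurable fun ω => ⌊s ω * ((n : ℝ) + 1)⌋ := (hs.mul_const _).floor
    have h3 : Measurable fun ω => ⌊u ω * ((n : ℝ) + 1)⌋ := (hu.mul_const _).floor
    have h4 : Measurable fun ω => (f ω, ⌊s ω * ((n : ℝ) + 1)⌋, ⌊u ω * ((n : ℝ) + 1)⌋) :=
      hf.prodMk (h2.prodMk h3)
    exact h1.comp h4
  refine measurable_of_eventually_eq key fun ω => ?_
  have ts := tendsto_floor_mul_div (s ω)
  have tu := tendsto_floor_mul_div (u ω)
  have le (r : ℝ) (n : ℕ) : (⌊r * ((n : ℝ) + 1)⌋ : ℝ) / ((n : ℝ) + 1) ≤ r := by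
    have hn : (0 : ℝ) < (n : ℝ) + 1 := by positivity
    rw [div_le_iff₀ hn]
    exact Int.floor_le _
  refine (f ω).eventually_count_eq i (s ω - 1) (u ω) ?_
    (fun p hp => ⟨by linarith [hp.1], hp.2.le⟩) fun p => ?_
  · filter_upwards [ts.eventually_const_le (sub_one_lt (s ω))] with n hn p hp
    exact ⟨hn.trans hp.1, hp.2.le.trans (le _ _)⟩
  · have e1 : ∀ᶠ n : ℕ in atTop, (⌊s ω * ((n : ℝ) + 1)⌋ : ℝ) / ((n : ℝ) + 1) ≤ p ↔ s ω ≤ p := by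
      by_cases hp : s ω ≤ p
      · exact Eventually.of_forall fun n => iff_of_true ((le _ _).trans hp) hp
      · filter_upwards [ts.eventually_const_lt (not_le.1 hp)] with n hn
        exact iff_of_false (not_le.2 hn) hp
    have e2 : ∀ᶠ n : ℕ in atTop, p < (⌊u ω * ((n : ℝ) + 1)⌋ : ℝ) / ((n : ℝ) + 1) ↔ p < u ω := by
      by_cases hp : p < u ω
      · filter_upwards [tu.eventually_const_lt hp] with n hn
        exact iff_of_true hn hp
      · exact Eventually.of_forall fun n =>
          iff_of_false (not_lt.2 ((le _ _).trans (not_lt.1 hp))) hp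
    filter_upwards [e1, e2] with n h1 h2
    exact and_congr h1 h2

/-- The counts in `(s, u]` are the limits of the counts in `[s + 1 / n, u + 1 / n)`. -/
theorem Config.measurable_count_Ioc {I α : Type*} [MeasurableSpace α] (i : I) {f : α → Config I}
    {s u : α → ℝ} (hf : Measurable f) (hs : Measurable s) (hu : Measurable u) :
    Measurable fun ω => (f ω).count i (Ioc (s ω) (u ω)) := by
  refine measurable_of_eventually_eq (fun n : ℕ => Config.measurable_count_Ico i hf
    (hs.add_const (1 / ((n : ℝ) + 1))) (hu.add_const (1 / ((n : ℝ) + 1)))) fun ω => ?_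
  have ts := tendsto_add_one_div_nat (s ω)
  have tu := tendsto_add_one_div_nat (u ω)
  have pos (n : ℕ) : 0 < 1 / ((n : ℝ) + 1) := by positivity
  refine (f ω).eventually_count_eq i (s ω) (u ω + 1) ?_
    (fun p hp => ⟨hp.1.le, by linarith [hp.2]⟩) fun p => ?_
  · filter_upwards [tu.eventually_le_const (lt_add_one (u ω))] with n hn p hp
    exact ⟨by linarith [hp.1, pos n], hp.2.le.trans hn⟩
  · have e1 : ∀ᶠ n : ℕ in atTop, s ω + 1 / ((n : ℝ) + 1) ≤ p ↔ s ω < p := by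
      by_cases hp : s ω < p
      · filter_upwards [ts.eventually_le_const hp] with n hn
        exact iff_of_true hn hp
      · exact Eventually.of_forall fun n => iff_of_false (by linarith [pos n]) hp
    have e2 : ∀ᶠ n : ℕ in atTop, p < u ω + 1 / ((n : ℝ) + 1) ↔ p ≤ u ω := by
      by_cases hp : p ≤ u ω
      · exact Eventually.of_forall fun n => iff_of_true (by linarith [pos n]) hp
      · filter_upwards [tu.eventually_le_const (not_le.1 hp)] with n hn
        exact iff_of_false (not_lt.2 hn) hp
    filter_upwards [e1, e2] with n h1 h2
    exact and_congr h1 h2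

/-- The bound on `B` matters, since `count` is zero by convention for infinitely many points. -/
theorem Config.count_eq_zero_iff {I : Type*} (x : Config I) (i : I) {B : Set ℝ} (c d : ℝ)
    (hB : B ⊆ Icc c d) : x.count i B = 0 ↔ ∀ s ∈ x.pts i, s ∉ B := by
  unfold Config.count
  rw [Set.ncard_eq_zero ((x.locFinite i c d).subset (inter_subset_inter_right _ hB)),
    Set.eq_empty_iff_forall_notMem]
  exact ⟨fun h s hs hB => h s ⟨hs, hB⟩, fun h s hs => h s hs.1 hs.2⟩

theorem Config.measurableSet_mem {I α : Type*} [MeasurableSpace α] (i : I) {f : α → Config I}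
    {t : α → ℝ} (hf : Measurable f) (ht : Measurable t) :
    MeasurableSet {ω | t ω ∈ (f ω).pts i} := by
  have h : Measurable fun ω => (f ω).count i (Icc (t ω) (t ω)) := by
    refine measurable_of_eventually_eq (fun n : ℕ => Config.measurable_count_Ico i hf
      ht (ht.add_const (1 / ((n : ℝ) + 1)))) fun ω => ?_
    have tt := tendsto_add_one_div_nat (t ω)
    have pos (n : ℕ) : 0 < 1 / ((n : ℝ) + 1) := by positivity
    refine (f ω).eventually_count_eq i (t ω) (t ω + 1) ?_
      (fun p hp => ⟨hp.1, by linarith [hp.2]⟩) fun p => ?_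
    · filter_upwards [tt.eventually_le_const (lt_add_one (t ω))] with n hn p hp
      exact ⟨hp.1, hp.2.le.trans hn⟩
    · have e2 : ∀ᶠ n : ℕ in atTop, p < t ω + 1 / ((n : ℝ) + 1) ↔ p ≤ t ω := by
        by_cases hp : p ≤ t ω
        · exact Eventually.of_forall fun n => iff_of_true (by linarith [pos n]) hp
        · filter_upwards [tt.eventually_le_const (not_le.1 hp)] with n hn
          exact iff_of_false (not_lt.2 hn) hp
      filter_upwards [e2] with n h2
      exact and_congr Iff.rfl h2
  convert (h (measurableSet_singleton 0)).compl using 1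
  ext ω
  simp only [mem_ofPred_eq, mem_compl_iff, mem_preimage, mem_singleton_iff,
    Config.count_eq_zero_iff (f ω) i (t ω) (t ω) subset_rfl]
  simp

theorem Config.measurableSet_pts_subset {I α : Type*} [MeasurableSpace α] (i : I)
    {f : α → Config I} {t : α → ℝ} (hf : Measurable f) (ht : Measurable t) :
    MeasurableSet {ω | (f ω).pts i ⊆ Ioc 0 (t ω)} := by
  have h1 (n : ℕ) : MeasurableSet {ω | (f ω).count i (Ioc (-(n : ℝ)) 0) = 0} :=
    (Config.measurable_count_Ioc i hf measurable_const measurable_const)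
      (measurableSet_singleton 0)
  have h2 (n : ℕ) : MeasurableSet {ω | (f ω).count i (Ioc (t ω) n) = 0} :=
    (Config.measurable_count_Ioc i hf ht measurable_const) (measurableSet_singleton 0)
  convert (MeasurableSet.iInter h1).inter (MeasurableSet.iInter h2) using 1
  ext ω
  simp only [mem_ofPred_eq, mem_inter_iff, mem_iInter,
    (f ω).count_eq_zero_iff i _ _ Ioc_subset_Icc_self]
  constructor
  · intro h
    exact ⟨fun n s hs hs' => absurd (h hs).1 (not_lt.2 hs'.2),
      fun n s hs hs' => absurd (h hs).2 (not_le.2 hs'.1)⟩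
  · rintro ⟨h, h'⟩ s hs
    refine ⟨?_, ?_⟩
    · by_contra hc
      obtain ⟨n, hn⟩ := exists_nat_gt (-s)
      exact h n s hs ⟨by linarith, not_lt.1 hc⟩
    · by_contra hc
      obtain ⟨n, hn⟩ := exists_nat_gt s
      exact h' n s hs ⟨not_le.1 hc, hn.le⟩

theorem Config.count_past {I : Type*} (x : Config I) (t : ℝ) (i : I) (a b : ℝ) :
    (x.past t).1.count i (Ico a b) = x.count i (Ico (a + t) (min b 0 + t)) := by
  unfold Config.count
  rw [← Set.ncard_image_of_injective _ (add_left_injective t)]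
  congr 1
  ext u
  constructor
  · rintro ⟨w, ⟨⟨hw0, hw⟩, hwa, hwb⟩, rfl⟩
    refine ⟨hw, ?_, ?_⟩
    · simpa using hwa
    · simpa using ⟨hwb, hw0⟩
  · rintro ⟨hu, hua, hub⟩
    have h1 : u - t < min b 0 := by linarith
    rw [lt_min_iff] at h1
    exact ⟨u - t, ⟨⟨h1.2, by simpa using hu⟩, by linarith, h1.1⟩, by simp⟩

theorem Config.measurable_past {I α : Type*} [MeasurableSpace α] {f : α → Config I}
    {t : α → ℝ} (hf : Measurable f) (ht : Measurable t) :
    Measurable fun ω => (f ω).past (t ω) := by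
  have h : Measurable fun ω => ((f ω).past (t ω)).1 := by
    refine Config.measurable_of_count fun i a b => ?_
    simp only [Config.count_past]
    exact Config.measurable_count_Ico i hf (ht.const_add a) (ht.const_add (min b 0))
  exact h.subtype_mk

open Classical in
theorem Config.count_insert {I : Type*} (x : Config I) (i : I) (t : ℝ) (j : I) {B : Set ℝ}
    (c d : ℝ) (hB : B ⊆ Icc c d) :
    (x.insert i t).count j B =
      x.count j B + if j = i ∧ t ∈ B ∧ ∀ k, t ∉ x.pts k then 1 else 0 := by
  unfold Config.count
  split_ifs with h
  · obtain ⟨rfl, htB, ht⟩ := h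
    have : (x.insert j t).pts j ∩ B = Insert.insert t (x.pts j ∩ B) := by
      ext s
      simp only [Config.insert, mem_inter_iff, mem_ofPred_eq, mem_insert_iff]
      constructor
      · rintro ⟨h | h, hs⟩
        · exact Or.inr ⟨h, hs⟩
        · exact Or.inl h.2.1
      · rintro (rfl | h)
        · exact ⟨Or.inr ⟨trivial, rfl, ht⟩, htB⟩
        · exact ⟨Or.inl h.1, h.2⟩
    rw [this, Set.ncard_insert_of_notMem (fun h => ht j h.1)
      ((x.locFinite j c d).subset (inter_subset_inter_right _ hB))]
  · rw [add_zero]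
    congr 1
    ext s
    simp only [Config.insert, mem_inter_iff, mem_ofPred_eq]
    constructor
    · rintro ⟨h' | h', hs⟩
      · exact ⟨h', hs⟩
      · exact absurd ⟨h'.1, h'.2.1 ▸ hs, h'.2.2⟩ h
    · rintro ⟨h', hs⟩
      exact ⟨Or.inl h', hs⟩

theorem Config.measurable_insert {I α : Type*} [Countable I] [MeasurableSpace α] (i : I)
    {f : α → Config I} {t : α → ℝ} (hf : Measurable f) (ht : Measurable t) :
    Measurable fun ω => (f ω).insert i (t ω) := by
  classical
  refine Config.measurable_of_count fun j a b => ?_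
  simp only [Config.count_insert _ i _ j a b Ico_subset_Icc_self]
  refine (Config.measurable_count_Ico j hf measurable_const measurable_const).add
    (Measurable.ite ?_ measurable_const measurable_const)
  refine (MeasurableSet.const _).inter ((ht measurableSet_Ico).inter ?_)
  have : {ω | ∀ k, t ω ∉ (f ω).pts k} = ⋂ k, {ω | t ω ∈ (f ω).pts k}ᶜ := by
    ext; simp
  change MeasurableSet {ω | ∀ k, t ω ∉ (f ω).pts k}
  rw [this]
  exact MeasurableSet.iInter fun k => (Config.measurableSet_mem k hf ht).compl

/-! ### Pasts, exit times and bounds on the intensities -/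

theorem Config.past_congr {I : Type*} {x y : Config I} {t : ℝ}
    (h : ∀ i, ∀ s < t, s ∈ x.pts i ↔ s ∈ y.pts i) : x.past t = y.past t := by
  refine Subtype.ext (Config.ext (funext fun i => Set.ext fun u => ?_))
  exact and_congr_right fun hu => h i (u + t) (by linarith)

theorem Config.past_insert {I : Type*} (x : Config I) (i : I) {t u : ℝ} (hu : u ≤ t) :
    (x.insert i t).past u = x.past u :=
  Config.past_congr fun j s hs =>
    ⟨fun h => h.resolve_right fun h' => by linarith [h'.2.1], fun h => Or.inl h⟩

/-- Without points in `[s, t)`, the past before `t` is the past before `s`, shifted. -/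
theorem Config.shift_past {I : Type*} {x : Config I} {s t : ℝ}
    (h : ∀ i, x.pts i ⊆ Iio s) : (x.past s).shift (t - s) = x.past t := by
  refine Subtype.ext (Config.ext (funext fun i => Set.ext fun u => ?_))
  change (u < 0 ∧ u + (t - s) < 0 ∧ u + (t - s) + s ∈ x.pts i) ↔ (u < 0 ∧ u + t ∈ x.pts i)
  have e : u + (t - s) + s = u + t := by ring
  rw [e]
  refine and_congr_right fun _ => ⟨fun h' => h'.2, fun h' => ⟨?_, h'⟩⟩
  have := h i h'
  rw [mem_Iio] at this
  linarith

section ExitTime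

variable {I : Type*} {Y : Set (PastConfig I)} {tmax : ℝ} {x : Config I} {t : ℝ}

theorem exitTime_nonneg (htmax : 0 < tmax) : 0 ≤ exitTime Y tmax x :=
  le_csInf ⟨tmax, Or.inr rfl⟩ (by rintro t (h | rfl); exacts [h.1, htmax.le])

theorem bddBelow_exitTime (htmax : 0 < tmax) :
    BddBelow ({t | 0 ≤ t ∧ x.past t ∉ Y} ∪ {tmax}) :=
  ⟨0, by rintro t (h | rfl); exacts [h.1, htmax.le]⟩

theorem past_mem_of_lt_exitTime (htmax : 0 < tmax) (h0 : 0 ≤ t) (ht : t < exitTime Y tmax x) :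
    x.past t ∈ Y := by
  by_contra hc
  exact absurd (csInf_le (bddBelow_exitTime htmax) (Or.inl ⟨h0, hc⟩)) (not_le.2 ht)

/-- A point added at a time `t` before the exit time does not make the process exit before `t`,
because the pasts up to time `t` do not contain it. -/
theorem le_exitTime_insert (htmax : 0 < tmax) (i : I) (ht : t ≤ exitTime Y tmax x) :
    t ≤ exitTime Y tmax (x.insert i t) := by
  refine le_csInf ⟨tmax, Or.inr rfl⟩ ?_
  rintro u (⟨h0, hu⟩ | rfl)
  · by_contra! hc
    rw [Config.past_insert _ _ hc.le] at hu
    exact hu (past_mem_of_lt_exitTime htmax h0 (hc.trans_le ht))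
  · exact ht.trans (csInf_le (bddBelow_exitTime htmax) (Or.inr rfl))

end ExitTime

section Bounds

variable {I : Type*} {V : I → Set (Set (I × ℝ))} {Y : Set (PastConfig I)}
  {φ : I → PastConfig I → ℝ≥0} {Δ : ∀ i, V i → PastConfig I → ℝ≥0} {lam : ∀ i, PMF (V i)}

theorem hasSum_kalikow
    (hΔsum : ∀ i, ∀ x ∈ Y, HasSum (fun v => Δ i v x) (φ i x))
    (hlam : ∀ i v, lam i v = 0 → ∀ x ∈ Y, Δ i v x = 0) (i : I) (x : PastConfig I) (hx : x ∈ Y) :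
    HasSum (fun v => (lam i v).toNNReal * kalikow lam Δ i v x) (φ i x) := by
  convert hΔsum i x hx using 2 with v
  unfold kalikow
  by_cases h : lam i v = 0
  · simp [h, hlam i v h x hx]
  · refine mul_div_cancel₀ _ ?_
    simp [ENNReal.toNNReal_eq_zero_iff, h, (lam i).apply_ne_top v]

theorem tsum_kalikow
    (hΔsum : ∀ i, ∀ x ∈ Y, HasSum (fun v => Δ i v x) (φ i x))
    (hlam : ∀ i v, lam i v = 0 → ∀ x ∈ Y, Δ i v x = 0) (i : I) (x : PastConfig I) (hx : x ∈ Y) :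
    ∑' v, lam i v * (kalikow lam Δ i v x : ℝ≥0∞) = φ i x := by
  have h := ENNReal.hasSum_coe.2 (hasSum_kalikow hΔsum hlam i x hx)
  rw [← h.tsum_eq]
  refine tsum_congr fun v => ?_
  rw [ENNReal.coe_mul, ENNReal.coe_toNNReal ((lam i).apply_ne_top v)]

/-- After time `T`, as long as no point has been added, the functions `φ^i_v` stay below the bound
that was computed at time `T`: the bound dominates their right limits at `T`, and they do not
increase while no points are added. -/
theorem kalikow_past_le {tmax : ℝ} {Γ : I → Config I → ℝ → ℝ≥0}
    (hmono : ∀ i v, ∀ t : ℝ, 0 ≤ t → ∀ x, kalikow lam Δ i v (x.shift t) ≤ kalikow lam Δ i v x)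
    (hΓbound : ∀ (X : Config I) (T : ℝ), 0 ≤ T → (∀ i, X.pts i ⊆ Ioc 0 T) →
      T < exitTime Y tmax X → ∀ i v, ∀ᶠ s in 𝓝[>] T, kalikow lam Δ i v (X.past s) ≤ Γ i X T)
    {X : Config I} {T u : ℝ} (hT : 0 ≤ T) (hX : ∀ i, X.pts i ⊆ Ioc 0 T)
    (hTτ : T < exitTime Y tmax X) (hu : T < u) (i : I) (v : V i) :
    kalikow lam Δ i v (X.past u) ≤ Γ i X T := by
  obtain ⟨s, hs, hs'⟩ := ((hΓbound X T hT hX hTτ i v).and (Ioo_mem_nhdsGT hu)).exists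
  rw [← Config.shift_past fun j p hp => lt_of_le_of_lt (hX j hp).2 hs'.1]
  exact (hmono i v _ (by linarith [hs'.2]) _).trans hs

end Bounds

/-! ### The states of the algorithm -/

section State

variable {I : Type*} {Y : Set (PastConfig I)} {tmax : ℝ} {Nmax : ℕ}

theorem State.measurable_X : Measurable (State.X : State I → Config I) :=
  measurable_fst

theorem State.measurable_T : Measurable (State.T : State I → ℝ≥0∞) :=
  measurable_fst.comp measurable_snd

theorem State.measurable_N : Measurable (State.N : State I → ℕ) :=
  measurable_snd.comp measurable_snd

/-- The condition of the loop. -/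
def State.Active (Y : Set (PastConfig I)) (tmax : ℝ) (Nmax : ℕ) (s : State I) : Prop :=
  s.T ≤ ENNReal.ofReal (exitTime Y tmax s.X) ∧ s.N ≤ Nmax

theorem State.measurableSet_active (hτ : Measurable (exitTime Y tmax)) :
    MeasurableSet {s : State I | s.Active Y tmax Nmax} :=
  (measurableSet_le State.measurable_T
    (hτ.comp State.measurable_X).ennreal_ofReal).inter (State.measurable_N measurableSet_Iic)

theorem State.measurable_bound {Γ : I → Config I → ℝ → ℝ≥0}
    (hΓ : ∀ i, Measurable fun p : Config I × ℝ => Γ i p.1 p.2) (i : I) :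
    Measurable fun s : State I => Γ i s.X s.T.toReal :=
  (hΓ i).comp (State.measurable_X.prodMk State.measurable_T.ennreal_toReal)

end State

/-! ### The transition kernel of the algorithm -/

section Kernel

variable {I : Type*} [Fintype I] {V : I → Set (Set (I × ℝ))} {lam : ∀ i, PMF (V i)}
  {φv : ∀ i, V i → PastConfig I → ℝ≥0}

theorem lintegral_thinning (g : I → ℝ≥0) (x : Config I) (t : ℝ) {f : Config I → ℝ≥0∞}
    (hf : Measurable f) :
    ∫⁻ y, f y ∂thinning lam φv g x t =
      ∑ i, ((g i / ∑ j, g j : ℝ≥0) : ℝ≥0∞) * ∑' v : V i, lam i v *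
        (((min 1 (φv i v (x.past t) / g i) : ℝ≥0) : ℝ≥0∞) * f (x.insert i t) +
          ((1 - min 1 (φv i v (x.past t) / g i) : ℝ≥0) : ℝ≥0∞) * f x) := by
  unfold thinning
  simp only [lintegral_finsetSum_measure, lintegral_smul_measure, lintegral_sum_measure,
    lintegral_add_measure, lintegral_dirac' _ hf, smul_eq_mul]

theorem measurable_lintegral_thinning {Ω : Type*} [MeasurableSpace Ω] [∀ i, Countable (V i)]
    (hφv : ∀ i v, Measurable (φv i v)) {g : Ω → I → ℝ≥0} (hg : ∀ i, Measurable fun ω => g ω i)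
    {x : Ω → Config I} (hx : Measurable x) {t : Ω → ℝ} (ht : Measurable t)
    {f : Ω → Config I → ℝ≥0∞} (hf : Measurable (Function.uncurry f)) :
    Measurable fun ω => ∫⁻ y, f ω y ∂thinning lam φv (g ω) (x ω) (t ω) := by
  have hf' (ω : Ω) : Measurable (f ω) := hf.comp measurable_prodMk_left
  simp only [fun ω => lintegral_thinning (lam := lam) (φv := φv) (g ω) (x ω) (t ω) (hf' ω)]
  refine Finset.measurable_sum _ fun i _ => ?_
  have hr : Measurable fun ω => ∑ j, g ω j := Finset.measurable_sum _ fun j _ => hg j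
  refine ((hg i).div hr).coe_nnreal_ennreal.mul (Measurable.tsum fun v => ?_)
  have hp : Measurable fun ω => min 1 (φv i v ((x ω).past (t ω)) / g ω i) :=
    measurable_const.min (((hφv i v).comp (Config.measurable_past hx ht)).div (hg i))
  have h1 : Measurable fun ω => f ω ((x ω).insert i (t ω)) :=
    hf.comp (measurable_id.prodMk (Config.measurable_insert i hx ht))
  have h2 : Measurable fun ω => f ω (x ω) := hf.comp (measurable_id.prodMk hx)
  exact ((hp.coe_nnreal_ennreal.mul h1).add
    ((measurable_const.sub hp).coe_nnreal_ennreal.mul h2)).const_mul _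

/-- The mean of a function under the thinning law, if accepting the proposed point in component `i`
increases its value by `δ i`. -/
theorem lintegral_thinning_of_add {g : I → ℝ≥0} (hr : ∑ j, g j ≠ 0) {x : Config I} {t : ℝ}
    {f : Config I → ℝ≥0∞} (hf : Measurable f) {δ : I → ℝ≥0∞}
    (h : ∀ i, f (x.insert i t) = f x + δ i) :
    ∫⁻ y, f y ∂thinning lam φv g x t = f x +
      ∑ i, ((g i / ∑ j, g j : ℝ≥0) : ℝ≥0∞) *
        ((∑' v : V i, lam i v * ((min 1 (φv i v (x.past t) / g i) : ℝ≥0) : ℝ≥0∞)) * δ i) := by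
  rw [lintegral_thinning g x t hf]
  have key (i : I) (v : V i) : lam i v *
        (((min 1 (φv i v (x.past t) / g i) : ℝ≥0) : ℝ≥0∞) * f (x.insert i t) +
          ((1 - min 1 (φv i v (x.past t) / g i) : ℝ≥0) : ℝ≥0∞) * f x) =
      lam i v * f x + lam i v * ((min 1 (φv i v (x.past t) / g i) : ℝ≥0) : ℝ≥0∞) * δ i := by
    set p := min 1 (φv i v (x.past t) / g i) with hp
    have h1 : (p : ℝ≥0∞) + ((1 - p : ℝ≥0) : ℝ≥0∞) = 1 := by
      rw [← ENNReal.coe_add, add_tsub_cancel_of_le (min_le_left _ _), ENNReal.coe_one]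
    calc lam i v * ((p : ℝ≥0∞) * f (x.insert i t) + ((1 - p : ℝ≥0) : ℝ≥0∞) * f x)
        = lam i v * (((p : ℝ≥0∞) + ((1 - p : ℝ≥0) : ℝ≥0∞)) * f x + p * δ i) := by
          rw [h]; ring
      _ = _ := by rw [h1]; ring
  simp only [key]
  have h2 : ∑ i, ((g i / ∑ j, g j : ℝ≥0) : ℝ≥0∞) = 1 := by
    rw [← ENNReal.ofNNReal_finsetSum, ← Finset.sum_div, div_self hr, ENNReal.coe_one]
  calc ∑ i, ((g i / ∑ j, g j : ℝ≥0) : ℝ≥0∞) * ∑' v : V i, (lam i v * f x +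
        lam i v * ((min 1 (φv i v (x.past t) / g i) : ℝ≥0) : ℝ≥0∞) * δ i)
      = ∑ i, (((g i / ∑ j, g j : ℝ≥0) : ℝ≥0∞) * f x + ((g i / ∑ j, g j : ℝ≥0) : ℝ≥0∞) *
        ((∑' v : V i, lam i v * ((min 1 (φv i v (x.past t) / g i) : ℝ≥0) : ℝ≥0∞)) * δ i)) := by
        refine Finset.sum_congr rfl fun i _ => ?_
        rw [ENNReal.tsum_add, ENNReal.tsum_mul_right, ENNReal.tsum_mul_right, (lam i).tsum_coe,
          one_mul, mul_add]
    _ = _ := by rw [Finset.sum_add_distrib, ← Finset.sum_mul, h2, one_mul]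

theorem lintegral_thinning_of_const {g : I → ℝ≥0} (hr : ∑ j, g j ≠ 0) {x : Config I} {t : ℝ}
    {f : Config I → ℝ≥0∞} (hf : Measurable f) (h : ∀ i, f (x.insert i t) = f x) :
    ∫⁻ y, f y ∂thinning lam φv g x t = f x := by
  rw [lintegral_thinning_of_add hr hf (δ := fun _ => 0) (by simpa using h)]
  simp

theorem lintegral_nextTimeLaw_zero (T : ℝ≥0∞) {f : ℝ≥0∞ → ℝ≥0∞} (hf : Measurable f) :
    ∫⁻ t, f t ∂nextTimeLaw T 0 = f ∞ := by
  simp [nextTimeLaw, lintegral_dirac' _ hf]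

theorem lintegral_nextTimeLaw {r : ℝ≥0} (hr : r ≠ 0) (T : ℝ≥0∞) {f : ℝ≥0∞ → ℝ≥0∞}
    (hf : Measurable f) :
    ∫⁻ t, f t ∂nextTimeLaw T r =
      ∫⁻ e in Ioi (0 : ℝ), ENNReal.ofReal (r * Real.exp (-(r * e))) * f (T + ENNReal.ofReal e) := by
  have h1 : Measurable fun e : ℝ => T + ENNReal.ofReal e := ENNReal.measurable_ofReal.const_add T
  have h2 : expMeasure (r : ℝ) = volume.withDensity (exponentialPDF r) := rfl
  have h3 : Measurable (exponentialPDF r) := (measurable_exponentialPDFReal r).ennreal_ofReal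
  rw [nextTimeLaw, if_neg hr, lintegral_map hf h1, h2,
    lintegral_withDensity_eq_lintegral_mul _ h3 (g := fun e => f (T + ENNReal.ofReal e))
      (hf.comp h1), ← lintegral_indicator measurableSet_Ioi]
  -- The density of the exponential law is supported on `[0, ∞)`, which differs from the domain of
  -- integration by the null set `{0}`.
  refine lintegral_congr_ae ?_
  filter_upwards [compl_mem_ae_iff.2 (measure_singleton (0 : ℝ))] with e he
  simp only [mem_compl_iff, mem_singleton_iff] at he
  simp only [Pi.mul_apply, indicator, mem_Ioi, exponentialPDF_eq]
  rcases lt_or_gt_of_ne he with he | he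
  · simp [not_le.2 he, not_lt.2 he.le]
  · simp [he, he.le]

theorem measurable_lintegral_nextTimeLaw {Ω : Type*} [MeasurableSpace Ω] {T : Ω → ℝ≥0∞}
    (hT : Measurable T) {r : Ω → ℝ≥0} (hr : Measurable r) {f : Ω → ℝ≥0∞ → ℝ≥0∞}
    (hf : Measurable (Function.uncurry f)) :
    Measurable fun ω => ∫⁻ t, f ω t ∂nextTimeLaw (T ω) (r ω) := by
  classical
  have hf' (ω : Ω) : Measurable (f ω) := hf.comp measurable_prodMk_left
  have : (fun ω => ∫⁻ t, f ω t ∂nextTimeLaw (T ω) (r ω)) = fun ω => if r ω = 0 then f ω ∞ else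
      ∫⁻ e in Ioi (0 : ℝ), ENNReal.ofReal (r ω * Real.exp (-(r ω * e))) *
        f ω (T ω + ENNReal.ofReal e) := by
    funext ω
    split_ifs with h
    · rw [h, lintegral_nextTimeLaw_zero _ (hf' ω)]
    · rw [lintegral_nextTimeLaw h _ (hf' ω)]
  rw [this]
  refine Measurable.ite (hr (measurableSet_singleton 0))
    (hf.comp (measurable_id.prodMk measurable_const)) ?_
  refine Measurable.lintegral_prod_right' (f := fun p : Ω × ℝ =>
    ENNReal.ofReal (r p.1 * Real.exp (-(r p.1 * p.2))) * f p.1 (T p.1 + ENNReal.ofReal p.2)) ?_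
  refine Measurable.mul (by fun_prop) ?_
  have h : Measurable fun p : Ω × ℝ => (p.1, T p.1 + ENNReal.ofReal p.2) := by fun_prop
  exact hf.comp h

variable {Γ : I → Config I → ℝ → ℝ≥0} {Y : Set (PastConfig I)} {tmax : ℝ} {Nmax : ℕ}

theorem step_of_not_active {s : State I} (hs : ¬ s.Active Y tmax Nmax) :
    step lam φv Γ Y tmax Nmax s = Measure.dirac s := if_neg hs

open Classical in
/-- The mean of `f` in the next state, if the algorithm is in state `s` and the next proposed time
is `t`. -/
noncomputable def stepMean (lam : ∀ i, PMF (V i)) (φv : ∀ i, V i → PastConfig I → ℝ≥0)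
    (Γ : I → Config I → ℝ → ℝ≥0) (Y : Set (PastConfig I)) (tmax : ℝ) (f : State I → ℝ≥0∞)
    (s : State I) (t : ℝ≥0∞) : ℝ≥0∞ :=
  if ENNReal.ofReal (exitTime Y tmax s.X) < t then f (s.X, t, s.N)
  else ∫⁻ x, f (x, t, s.N + 1) ∂thinning lam φv (fun i => Γ i s.X s.T.toReal) s.X t.toReal

theorem measurable_stepMean [∀ i, Countable (V i)] (hφv : ∀ i v, Measurable (φv i v))
    (hΓ : ∀ i, Measurable fun p : Config I × ℝ => Γ i p.1 p.2)
    (hτ : Measurable (exitTime Y tmax)) {f : State I → ℝ≥0∞} (hf : Measurable f) :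
    Measurable (Function.uncurry (stepMean lam φv Γ Y tmax f)) := by
  have hX : Measurable fun p : State I × ℝ≥0∞ => p.1.X := State.measurable_X.comp measurable_fst
  have hN : Measurable fun p : State I × ℝ≥0∞ => p.1.N := State.measurable_N.comp measurable_fst
  refine Measurable.ite (measurableSet_lt (hτ.comp hX).ennreal_ofReal measurable_snd) ?_ ?_
  · exact hf.comp (hX.prodMk (measurable_snd.prodMk hN))
  · refine measurable_lintegral_thinning (g := fun p i => Γ i p.1.X p.1.T.toReal)
      (x := fun p : State I × ℝ≥0∞ => p.1.X) (t := fun p => p.2.toReal)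
      (f := fun p y => f (y, p.2, p.1.N + 1)) hφv
      (fun i => (State.measurable_bound hΓ i).comp measurable_fst) hX
      (ENNReal.measurable_toReal.comp measurable_snd) ?_
    exact hf.comp (measurable_snd.prodMk ((measurable_snd.comp measurable_fst).prodMk
      ((hN.comp measurable_fst).add_const 1)))

theorem lintegral_step [∀ i, Countable (V i)] (hφv : ∀ i v, Measurable (φv i v))
    {s : State I} (hs : s.Active Y tmax Nmax)
    {f : State I → ℝ≥0∞} (hf : Measurable f) :
    ∫⁻ s', f s' ∂step lam φv Γ Y tmax Nmax s =
      ∫⁻ t, stepMean lam φv Γ Y tmax f s t ∂nextTimeLaw s.T (∑ i, Γ i s.X s.T.toReal) := by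
  have hm (t : ℝ≥0∞) : Measurable fun x : Config I => ((x, t, s.N + 1) : State I) := by fun_prop
  rw [step, if_pos (show s.T ≤ ENNReal.ofReal (exitTime Y tmax s.X) ∧ s.N ≤ Nmax from hs),
    Measure.lintegral_bind _ hf.aemeasurable]
  · refine lintegral_congr fun t => ?_
    unfold stepMean
    split_ifs with h
    · rw [lintegral_dirac' _ hf]
    · rw [lintegral_map hf (hm t)]
  · refine (Measurable.ite measurableSet_Ioi ?_ ?_).aemeasurable
    · exact Measure.measurable_dirac.comp (by fun_prop)
    · refine Measure.measurable_of_measurable_coe _ fun B hB => ?_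
      have hB1 : Measurable (B.indicator (1 : State I → ℝ≥0∞)) := measurable_one.indicator hB
      have h1 (t : ℝ≥0∞) :
          (thinning lam φv (fun i => Γ i s.X s.T.toReal) s.X t.toReal).map
            (fun x => ((x, t, s.N + 1) : State I)) B =
          ∫⁻ x, B.indicator 1 ((x, t, s.N + 1) : State I)
            ∂thinning lam φv (fun i => Γ i s.X s.T.toReal) s.X t.toReal := by
        rw [← lintegral_indicator_one hB, lintegral_map hB1 (hm t)]
      simp only [h1]
      refine measurable_lintegral_thinning (g := fun _ i => Γ i s.X s.T.toReal)
        (x := fun _ => s.X) (t := fun t : ℝ≥0∞ => t.toReal)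
        (f := fun t x => B.indicator 1 ((x, t, s.N + 1) : State I)) hφv
        (fun i => measurable_const) measurable_const ENNReal.measurable_toReal ?_
      exact hB1.comp (measurable_snd.prodMk (measurable_fst.prodMk measurable_const))

theorem measurable_step [∀ i, Countable (V i)] (hφv : ∀ i v, Measurable (φv i v))
    (hΓ : ∀ i, Measurable fun p : Config I × ℝ => Γ i p.1 p.2)
    (hτ : Measurable (exitTime Y tmax)) :
    Measurable (step lam φv Γ Y tmax Nmax) := by
  classical
  refine Measure.measurable_of_measurable_coe _ fun B hB => ?_
  have hB1 : Measurable (B.indicator (1 : State I → ℝ≥0∞)) := measurable_one.indicator hB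
  have h1 : (fun s => step lam φv Γ Y tmax Nmax s B) = fun s => if s.Active Y tmax Nmax then
      ∫⁻ t, stepMean lam φv Γ Y tmax (B.indicator 1) s t
        ∂nextTimeLaw s.T (∑ i, Γ i s.X s.T.toReal)
      else B.indicator 1 s := by
    funext s
    split_ifs with h
    · rw [← lintegral_indicator_one hB, lintegral_step hφv h hB1]
    · rw [step_of_not_active h, Measure.dirac_apply' _ hB]
  rw [h1]
  refine Measurable.ite (State.measurableSet_active hτ) ?_ hB1
  exact measurable_lintegral_nextTimeLaw State.measurable_T
    (Finset.measurable_sum _ fun i _ => State.measurable_bound hΓ i)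
    (measurable_stepMean hφv hΓ hτ hB1)

/-- With total rate zero the next time is `∞`, and the algorithm stops. -/
theorem lintegral_step_of_rate_eq_zero [∀ i, Countable (V i)] (hφv : ∀ i v, Measurable (φv i v))
    (hΓ : ∀ i, Measurable fun p : Config I × ℝ => Γ i p.1 p.2)
    (hτ : Measurable (exitTime Y tmax)) {s : State I} (hs : s.Active Y tmax Nmax)
    (hr : ∑ i, Γ i s.X s.T.toReal = 0) {f : State I → ℝ≥0∞} (hf : Measurable f) :
    ∫⁻ s', f s' ∂step lam φv Γ Y tmax Nmax s = f (s.X, ∞, s.N) := by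
  rw [lintegral_step hφv hs hf, hr, lintegral_nextTimeLaw_zero _
    ((measurable_stepMean hφv hΓ hτ hf).of_uncurry_left (x := s)),
    stepMean, if_pos ENNReal.ofReal_lt_top]

open Classical in
/-- With positive total rate `r`, the next time is `T + e` with `e` exponential of rate `r`. -/
theorem lintegral_step_of_rate_ne_zero [∀ i, Countable (V i)] (hφv : ∀ i v, Measurable (φv i v))
    (hΓ : ∀ i, Measurable fun p : Config I × ℝ => Γ i p.1 p.2)
    (hτ : Measurable (exitTime Y tmax)) {s : State I} (hs : s.Active Y tmax Nmax)
    {r : ℝ≥0} (hrs : ∑ i, Γ i s.X s.T.toReal = r) (hr : r ≠ 0)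
    {f : State I → ℝ≥0∞} (hf : Measurable f) :
    ∫⁻ s', f s' ∂step lam φv Γ Y tmax Nmax s =
      ∫⁻ e in Ioi (0 : ℝ), ENNReal.ofReal (r * Real.exp (-(r * e))) *
        if exitTime Y tmax s.X < s.T.toReal + e then
          f (s.X, ENNReal.ofReal (s.T.toReal + e), s.N)
        else ∫⁻ x, f (x, ENNReal.ofReal (s.T.toReal + e), s.N + 1)
          ∂thinning lam φv (fun i => Γ i s.X s.T.toReal) s.X (s.T.toReal + e) := by
  rw [lintegral_step hφv hs hf, hrs, lintegral_nextTimeLaw hr _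
    ((measurable_stepMean hφv hΓ hτ hf).of_uncurry_left (x := s))]
  refine setLIntegral_congr_fun measurableSet_Ioi fun e he => ?_
  have he' : (0 : ℝ) < e := he
  have hT : s.T + ENNReal.ofReal e = ENNReal.ofReal (s.T.toReal + e) := by
    rw [ENNReal.ofReal_add ENNReal.toReal_nonneg he'.le, ENNReal.ofReal_toReal
      (ne_top_of_le_ne_top ENNReal.ofReal_ne_top hs.1)]
  have hpos : 0 < s.T.toReal + e := add_pos_of_nonneg_of_pos ENNReal.toReal_nonneg he'
  simp only [stepMean, hT, ENNReal.ofReal_lt_ofReal_iff hpos,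
    ENNReal.toReal_ofReal hpos.le]

theorem lintegral_exp_density {r : ℝ≥0} (hr : r ≠ 0) :
    ∫⁻ e in Ioi (0 : ℝ), ENNReal.ofReal (r * Real.exp (-(r * e))) = 1 := by
  have := lintegral_nextTimeLaw hr 0 (f := fun _ => 1) measurable_const
  have h2 := isProbabilityMeasure_expMeasure (NNReal.coe_pos.2 (pos_iff_ne_zero.2 hr))
  have h3 : IsProbabilityMeasure (nextTimeLaw 0 r) := by
    rw [nextTimeLaw, if_neg hr]
    exact Measure.isProbabilityMeasure_map (ENNReal.measurable_ofReal.const_add 0).aemeasurable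
  simpa using this.symm

/-- A measurable set of states has full measure under the law of the next state if it contains all
the possible next states. -/
theorem ae_step [∀ i, Countable (V i)] (hφv : ∀ i v, Measurable (φv i v))
    (hΓ : ∀ i, Measurable fun p : Config I × ℝ => Γ i p.1 p.2)
    (hτ : Measurable (exitTime Y tmax)) {s : State I} (hs : s.Active Y tmax Nmax)
    {B : Set (State I)} (hB : MeasurableSet B)
    (hend : ∀ t, ENNReal.ofReal (exitTime Y tmax s.X) < t → (s.X, t, s.N) ∈ B)
    (hrej : ∀ t, s.T.toReal < t → t ≤ exitTime Y tmax s.X →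
      (s.X, ENNReal.ofReal t, s.N + 1) ∈ B)
    (hacc : ∀ t, s.T.toReal < t → t ≤ exitTime Y tmax s.X → ∀ i,
      (s.X.insert i t, ENNReal.ofReal t, s.N + 1) ∈ B) :
    ∀ᵐ s' ∂step lam φv Γ Y tmax Nmax s, s' ∈ B := by
  have hf : Measurable (Bᶜ.indicator (1 : State I → ℝ≥0∞)) := measurable_one.indicator hB.compl
  have h0 {s'} (h : s' ∈ B) : Bᶜ.indicator (1 : State I → ℝ≥0∞) s' = 0 := by simp [h]
  rw [ae_iff]
  change step lam φv Γ Y tmax Nmax s Bᶜ = 0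
  rw [← lintegral_indicator_one hB.compl]
  by_cases hr : ∑ i, Γ i s.X s.T.toReal = 0
  · rw [lintegral_step_of_rate_eq_zero hφv hΓ hτ hs hr hf, h0 (hend _ ENNReal.ofReal_lt_top)]
  · rw [lintegral_step_of_rate_ne_zero hφv hΓ hτ hs rfl hr hf,
      setLIntegral_congr_fun (g := fun _ => 0) measurableSet_Ioi, lintegral_zero]
    intro e he
    have ht : s.T.toReal < s.T.toReal + e := lt_add_of_pos_right _ he
    simp only
    split_ifs with h
    · rw [h0 (hend _ ((ENNReal.ofReal_lt_ofReal_iff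
        (ENNReal.toReal_nonneg.trans_lt ht)).2 h)), mul_zero]
    · rw [lintegral_thinning_of_const hr
        (f := fun x => Bᶜ.indicator 1 ((x, ENNReal.ofReal (s.T.toReal + e), s.N + 1) : State I))
        (hf.comp (by fun_prop)), h0 (hrej _ ht (not_lt.1 h)),
        mul_zero]
      intro i
      rw [h0 (hrej _ ht (not_lt.1 h)), h0 (hacc _ ht (not_lt.1 h) i)]

theorem isProbabilityMeasure_step [∀ i, Countable (V i)] (hφv : ∀ i v, Measurable (φv i v))
    (hΓ : ∀ i, Measurable fun p : Config I × ℝ => Γ i p.1 p.2)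
    (hτ : Measurable (exitTime Y tmax)) (s : State I) :
    IsProbabilityMeasure (step lam φv Γ Y tmax Nmax s) := by
  by_cases hs : s.Active Y tmax Nmax
  · refine ⟨?_⟩
    rw [← lintegral_one]
    by_cases hr : ∑ i, Γ i s.X s.T.toReal = 0
    · rw [lintegral_step_of_rate_eq_zero hφv hΓ hτ hs hr measurable_const]
    · rw [lintegral_step_of_rate_ne_zero hφv hΓ hτ hs rfl hr measurable_const]
      refine Eq.trans ?_ (lintegral_exp_density hr)
      refine setLIntegral_congr_fun measurableSet_Ioi fun e _ => ?_
      have h1 (x : Config I) (t : ℝ) : ∫⁻ _, 1 ∂thinning lam φv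
          (fun i => Γ i s.X s.T.toReal) x t = 1 :=
        lintegral_thinning_of_const hr (f := fun _ => 1) measurable_const fun _ => rfl
      simp only [h1, ite_self, mul_one]
  · rw [step_of_not_active hs]
    infer_instance

theorem isProbabilityMeasure_stateLaw [∀ i, Countable (V i)] (hφv : ∀ i v, Measurable (φv i v))
    (hΓ : ∀ i, Measurable fun p : Config I × ℝ => Γ i p.1 p.2)
    (hτ : Measurable (exitTime Y tmax)) (n : ℕ) :
    IsProbabilityMeasure (stateLaw lam φv Γ Y tmax Nmax n) := by
  induction n with
  | zero => exact Measure.dirac.isProbabilityMeasure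
  | succ n ih =>
    refine ⟨?_⟩
    have (s : State I) := isProbabilityMeasure_step (lam := lam) (Nmax := Nmax) hφv hΓ hτ s
    rw [stateLaw, Measure.bind_apply .univ (measurable_step hφv hΓ hτ).aemeasurable]
    simp

end Kernel

/-! ### The compensator of one exponential waiting time -/

theorem lintegral_exp_density_Ici {r : ℝ≥0} (hr : r ≠ 0) (u : ℝ) :
    ∫⁻ e in Ici u, ENNReal.ofReal (r * Real.exp (-(r * e))) =
      ENNReal.ofReal (Real.exp (-(r * u))) := by
  have hr' : (0 : ℝ) < r := NNReal.coe_pos.2 (pos_iff_ne_zero.2 hr)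
  have hd : ∀ x ∈ Ici u, HasDerivAt (fun a => -Real.exp (-((r : ℝ) * a)))
      (r * Real.exp (-(r * x))) x := fun x _ => hasDerivAt_neg_exp_mul_exp
  have h0 : ∀ x ∈ Ioi u, 0 ≤ (r : ℝ) * Real.exp (-(r * x)) := fun x _ => by positivity
  have ht : Tendsto (fun a => -Real.exp (-((r : ℝ) * a))) atTop (𝓝 0) := by
    rw [← neg_zero]
    exact (Real.tendsto_exp_neg_atTop_nhds_zero.comp
      (tendsto_id.const_mul_atTop hr')).neg
  rw [← setLIntegral_congr Ioi_ae_eq_Ici, ← ofReal_integral_eq_lintegral_ofReal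
    (integrableOn_Ioi_deriv_of_nonneg' hd h0 ht)
    ((ae_restrict_iff' measurableSet_Ioi).2 (Eventually.of_forall h0)),
    integral_Ioi_of_hasDerivAt_of_nonneg' hd h0 ht, zero_sub, neg_neg]

/-- If `e` is exponential with rate `r`, then `E[∫_T^{T+e} ψ(u) du] = E[ψ(T + e)] / r`, because the
density of `e` at `u` is `r` times the probability of `u ≤ e`. -/
theorem lintegral_exp_density_mul_lintegral {r : ℝ≥0} (hr : r ≠ 0) (T : ℝ) {ψ : ℝ → ℝ≥0∞}
    (hψ : Measurable ψ) :
    ∫⁻ e in Ioi (0 : ℝ), ENNReal.ofReal (r * Real.exp (-(r * e))) *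
        ∫⁻ u in Ioc T (T + e), ψ u =
      ∫⁻ e in Ioi (0 : ℝ), ENNReal.ofReal (r * Real.exp (-(r * e))) *
        ((r : ℝ≥0∞)⁻¹ * ψ (T + e)) := by
  set w : ℝ → ℝ≥0∞ := fun e => ENNReal.ofReal (r * Real.exp (-(r * e))) with hw
  have hwm : Measurable w := by fun_prop
  have hψ' : Measurable fun u => ψ (T + u) := hψ.comp (measurable_const_add T)
  have shift (e : ℝ) : ∫⁻ u in Ioc T (T + e), ψ u = ∫⁻ u in Ioc 0 e, ψ (T + u) := by
    rw [← lintegral_indicator measurableSet_Ioc, ← lintegral_indicator measurableSet_Ioc,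
      ← lintegral_add_left_eq_self _ T]
    refine lintegral_congr fun u => ?_
    simp only [indicator, mem_Ioc, lt_add_iff_pos_right, add_le_add_iff_left]
  set G : ℝ → ℝ → ℝ≥0∞ := fun e u =>
    {p : ℝ × ℝ | 0 < p.2 ∧ p.2 ≤ p.1}.indicator (fun p => w p.1 * ψ (T + p.2)) (e, u) with hG
  have hGm : Measurable (Function.uncurry G) := by
    refine Measurable.indicator ((hwm.comp measurable_fst).mul (hψ'.comp measurable_snd)) ?_
    exact (measurableSet_lt measurable_const measurable_snd).inter
      (measurableSet_le measurable_snd measurable_fst)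
  calc ∫⁻ e in Ioi (0 : ℝ), w e * ∫⁻ u in Ioc T (T + e), ψ u
      = ∫⁻ e, ∫⁻ u, G e u := by
        rw [← lintegral_indicator measurableSet_Ioi]
        refine lintegral_congr fun e => ?_
        by_cases he : 0 < e
        · rw [indicator_of_mem (show e ∈ Ioi 0 from he), shift,
            ← lintegral_const_mul _ hψ', ← lintegral_indicator measurableSet_Ioc]
          rfl
        · rw [indicator_of_notMem (show e ∉ Ioi 0 from he)]
          refine ((lintegral_congr fun u => ?_).trans lintegral_zero).symm
          exact indicator_of_notMem (fun h => he (h.1.trans_le h.2)) _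
    _ = ∫⁻ u, ∫⁻ e, G e u := lintegral_lintegral_swap hGm.aemeasurable
    _ = ∫⁻ u in Ioi (0 : ℝ), w u * ((r : ℝ≥0∞)⁻¹ * ψ (T + u)) := by
        rw [← lintegral_indicator measurableSet_Ioi]
        refine lintegral_congr fun u => ?_
        by_cases hu : 0 < u
        · have h1 : ∫⁻ e, G e u = ∫⁻ e in Ici u, w e * ψ (T + u) := by
            rw [← lintegral_indicator measurableSet_Ici]
            refine lintegral_congr fun e => ?_
            simp [hG, indicator, hu]
          have h2 : w u * (r : ℝ≥0∞)⁻¹ = ENNReal.ofReal (Real.exp (-(r * u))) := by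
            rw [hw]
            simp only
            rw [ENNReal.ofReal_mul r.coe_nonneg, ENNReal.ofReal_coe_nnreal, mul_comm, ← mul_assoc,
              ENNReal.inv_mul_cancel (by simpa using hr) ENNReal.coe_ne_top, one_mul]
          rw [indicator_of_mem (show u ∈ Ioi 0 from hu), h1, lintegral_mul_const _ hwm,
            lintegral_exp_density_Ici hr, ← mul_assoc, h2]
        · rw [indicator_of_notMem (show u ∉ Ioi 0 from hu)]
          refine (lintegral_congr fun e => ?_).trans lintegral_zero
          exact indicator_of_notMem (fun h => hu h.1) _

/-! ### Horizon, counts, compensator and history as functions of the state -/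

section Horizon

variable {I : Type*} {Y : Set (PastConfig I)} {tmax : ℝ}

theorem State.horizon_eq_toReal {s : State I}
    (h : s.T ≤ ENNReal.ofReal (exitTime Y tmax s.X)) : s.horizon Y tmax = s.T.toReal := by
  rw [State.horizon, min_eq_right h]

theorem State.horizon_of_exitTime_lt (htmax : 0 < tmax) {x : Config I} {t : ℝ≥0∞} (n : ℕ)
    (h : ENNReal.ofReal (exitTime Y tmax x) < t) :
    State.horizon Y tmax (x, t, n) = exitTime Y tmax x := by
  have h1 : State.horizon Y tmax (x, t, n) =
    (min (ENNReal.ofReal (exitTime Y tmax x)) t).toReal := rfl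
  rw [h1, min_eq_left h.le, ENNReal.toReal_ofReal (exitTime_nonneg htmax)]

theorem State.horizon_of_le_exitTime {x : Config I} {t : ℝ} (n : ℕ) (h0 : 0 ≤ t)
    (h : t ≤ exitTime Y tmax x) :
    State.horizon Y tmax (x, ENNReal.ofReal t, n) = t := by
  have h1 : State.horizon Y tmax (x, ENNReal.ofReal t, n) =
    (min (ENNReal.ofReal (exitTime Y tmax x)) (ENNReal.ofReal t)).toReal := rfl
  rw [h1, min_eq_right (ENNReal.ofReal_le_ofReal h), ENNReal.toReal_ofReal h0]

theorem State.horizon_le_exitTime (htmax : 0 < tmax) (s : State I) :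
    s.horizon Y tmax ≤ exitTime Y tmax s.X :=
  ENNReal.toReal_le_of_le_ofReal (exitTime_nonneg htmax) (min_le_left _ _)

theorem exitTime_le {x : Config I} (htmax : 0 < tmax) : exitTime Y tmax x ≤ tmax :=
  csInf_le (bddBelow_exitTime htmax) (Or.inr rfl)

theorem State.measurable_horizon (hτ : Measurable (exitTime Y tmax)) :
    Measurable (State.horizon Y tmax) :=
  ((hτ.comp State.measurable_X).ennreal_ofReal.min State.measurable_T).ennreal_toReal

/-- The number of points of component `i` in `(a, b]` up to the horizon. -/
noncomputable def State.countUpTo (Y : Set (PastConfig I)) (tmax : ℝ) (i : I) (a b : ℝ)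
    (s : State I) : ℝ≥0∞ :=
  (s.X.count i (Ioc a b ∩ Iic (s.horizon Y tmax)) : ℝ≥0∞)

/-- The integral over `(a, b]`, up to the horizon, of the intensity `φ i` along the configuration.
-/
noncomputable def State.compensator (φ : I → PastConfig I → ℝ≥0) (Y : Set (PastConfig I))
    (tmax : ℝ) (i : I) (a b : ℝ) (s : State I) : ℝ≥0∞ :=
  ∫⁻ u in Ioc a b ∩ Iic (s.horizon Y tmax), (φ i (s.X.past u) : ℝ≥0∞)

theorem State.measurable_countUpTo (hτ : Measurable (exitTime Y tmax)) (i : I) (a b : ℝ) :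
    Measurable (State.countUpTo Y tmax i a b) := by
  have h : Measurable fun s : State I => s.X.count i (Ioc a (b ⊓ s.horizon Y tmax)) :=
    Config.measurable_count_Ioc i State.measurable_X measurable_const
      (measurable_const.min (State.measurable_horizon hτ))
  simp only [← Ioc_inter_Iic] at h
  have h' : Measurable fun n : ℕ => (n : ℝ≥0∞) := measurable_from_top
  exact h'.comp h

variable {φ : I → PastConfig I → ℝ≥0}

theorem measurable_intensity_past {i : I} (hφ : Measurable (φ i)) (x : Config I) :
    Measurable fun u : ℝ => (φ i (x.past u) : ℝ≥0∞) :=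
  (hφ.comp (Config.measurable_past measurable_const measurable_id)).coe_nnreal_ennreal

theorem State.measurable_compensator (hτ : Measurable (exitTime Y tmax))
    {i : I} (hφ : Measurable (φ i)) (a b : ℝ) :
    Measurable (State.compensator φ Y tmax i a b) := by
  have h1 : State.compensator φ Y tmax i a b = fun s : State I => ∫⁻ u,
      {p : State I × ℝ | p.2 ∈ Ioc a b ∧ p.2 ≤ p.1.horizon Y tmax}.indicator
        (fun p => (φ i (p.1.X.past p.2) : ℝ≥0∞)) (s, u) := by
    funext s
    rw [State.compensator, ← lintegral_indicator (measurableSet_Ioc.inter measurableSet_Iic)]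
    rfl
  rw [h1]
  refine Measurable.lintegral_prod_right' (Measurable.indicator ?_ ?_)
  · exact (hφ.comp (Config.measurable_past (State.measurable_X.comp measurable_fst)
      measurable_snd)).coe_nnreal_ennreal
  · exact (measurable_snd measurableSet_Ioc).inter (measurableSet_le measurable_snd
      ((State.measurable_horizon hτ).comp measurable_fst))

theorem State.countUpTo_eq {s : State I} {i : I} (h : s.X.pts i ⊆ Iic (s.horizon Y tmax))
    (a b : ℝ) : s.countUpTo Y tmax i a b = s.X.count i (Ioc a b) := by
  unfold State.countUpTo Config.count
  congr 2
  ext p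
  exact ⟨fun hp => ⟨hp.1, hp.2.1⟩, fun hp => ⟨hp.1, hp.2, h hp.1⟩⟩

theorem State.countUpTo_of_horizon_le {s : State I} {a : ℝ} (h : s.horizon Y tmax ≤ a) (i : I)
    (b : ℝ) : s.countUpTo Y tmax i a b = 0 := by
  rw [State.countUpTo, Nat.cast_eq_zero, Ioc_inter_Iic, Ioc_eq_empty (by simp [h])]
  simp [Config.count]

theorem State.compensator_of_horizon_le {s : State I} {a : ℝ} (h : s.horizon Y tmax ≤ a) (i : I)
    (b : ℝ) : s.compensator φ Y tmax i a b = 0 := by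
  rw [State.compensator, Ioc_inter_Iic, Ioc_eq_empty (by simp [h])]
  simp

/-- The increment of the compensator, if the horizon moves from `T` to `τ ∧ t` and the
configuration does not change strictly before the new horizon. -/
theorem State.compensator_eq_add {s s' : State I} {i : I} {T τ t : ℝ}
    (hT : s.horizon Y tmax = T) (hT' : s'.horizon Y tmax = min τ t)
    (hle : T ≤ min τ t) (hpast : ∀ u ≤ min τ t, s'.X.past u = s.X.past u) (a b : ℝ) :
    s'.compensator φ Y tmax i a b = s.compensator φ Y tmax i a b +
      ∫⁻ u in Ioc T t, (Ioc a b ∩ Iic τ).indicator (fun u => (φ i (s.X.past u) : ℝ≥0∞)) u := by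
  rw [State.compensator, State.compensator, hT, hT',
    setLIntegral_indicator (measurableSet_Ioc.inter measurableSet_Iic),
    setLIntegral_congr_fun (g := fun u => (φ i (s.X.past u) : ℝ≥0∞))
      (measurableSet_Ioc.inter measurableSet_Iic) (fun u hu => by simp only [hpast u hu.2]),
    ← lintegral_union ((measurableSet_Ioc.inter measurableSet_Iic).inter measurableSet_Ioc)]
  · congr 2
    ext u
    have := le_min_iff.1 hle
    simp only [mem_inter_iff, mem_Iic, mem_union, mem_Ioc, le_min_iff]
    constructor
    · rintro ⟨h1, h2, h3⟩
      rcases le_or_gt u T with h | h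
      · exact Or.inl ⟨h1, h⟩
      · exact Or.inr ⟨⟨h1, h2⟩, h, h3⟩
    · rintro (⟨h1, h2⟩ | ⟨⟨h1, h2⟩, h, h3⟩)
      · exact ⟨h1, h2.trans this.1, h2.trans this.2⟩
      · exact ⟨h1, h2, h3⟩
  · exact Set.disjoint_left.2 fun u hu hu' => absurd hu.2 (not_le.2 hu'.2.1)

end Horizon

section History

variable {Ω I : Type*} {X : Ω → Config I} {H : Ω → ℝ} {a : ℝ} {A : Set Ω}

theorem history_le [MeasurableSpace Ω] (hX : Measurable X) (hH : Measurable H) :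
    history X H a ≤ ‹MeasurableSpace Ω› := by
  refine sup_le ?_ (MeasurableSpace.generateFrom_le ?_)
  · refine iSup_le fun j => iSup_le fun s => iSup_le fun _ => ?_
    exact measurable_iff_comap_le.1
      (Config.measurable_count_Ioc j hX measurable_const measurable_const)
  · rintro _ ⟨s, -, rfl⟩
    exact hH measurableSet_Iic

/-- An event of the history at time `a` does not distinguish two outcomes with horizon beyond `a`
and the same points up to time `a`. -/
theorem mem_iff_of_measurableSet_history (hA : MeasurableSet[history X H a] A) {ω ω' : Ω}
    (hω : a < H ω) (hω' : a < H ω')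
    (h : ∀ j, ∀ p ≤ a, p ∈ (X ω).pts j ↔ p ∈ (X ω').pts j) : ω ∈ A ↔ ω' ∈ A := by
  -- The sets that do not distinguish `ω` and `ω'` form a sigma-algebra.
  let m : MeasurableSpace Ω := MeasurableSpace.map (fun c : Bool => if c then ω else ω') ⊥
  have hm (B : Set Ω) : MeasurableSet[m] B ↔ (ω ∈ B ↔ ω' ∈ B) := by
    change MeasurableSet[⊥] _ ↔ _
    rw [MeasurableSpace.measurableSet_bot_iff]
    constructor
    · rintro (h | h)
      · have h1 : true ∉ (fun c : Bool => if c then ω else ω') ⁻¹' B := by rw [h]; simp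
        have h2 : false ∉ (fun c : Bool => if c then ω else ω') ⁻¹' B := by rw [h]; simp
        exact iff_of_false h1 h2
      · have h1 : true ∈ (fun c : Bool => if c then ω else ω') ⁻¹' B := by rw [h]; simp
        have h2 : false ∈ (fun c : Bool => if c then ω else ω') ⁻¹' B := by rw [h]; simp
        exact iff_of_true h1 h2
    · intro h
      by_cases hB : ω' ∈ B
      · right
        ext c
        cases c
        · simpa using hB
        · simpa using h.2 hB
      · left
        ext c
        cases c
        · simpa using hB
        · simpa using fun h' => hB (h.1 h')
  have hle : history X H a ≤ m := by
    refine sup_le ?_ (MeasurableSpace.generateFrom_le ?_)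
    · refine iSup_le fun j => iSup_le fun s => iSup_le fun hs => ?_
      rintro _ ⟨C, -, rfl⟩
      have : (X ω).count j (Ioc 0 s) = (X ω').count j (Ioc 0 s) := by
        unfold Config.count
        congr 1
        ext p
        exact and_congr_left fun hp => h j p (hp.2.trans hs)
      rw [hm, mem_preimage, mem_preimage, this]
    · rintro _ ⟨s, hs, rfl⟩
      rw [hm]
      exact iff_of_false (not_le.2 (hs.trans_lt hω)) (not_le.2 (hs.trans_lt hω'))
  exact (hm A).1 (hle A hA)

end History

/-! ### One run of the loop -/

section Loop

variable {I : Type*} {V : I → Set (Set (I × ℝ))}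

/-- What the analysis of the algorithm uses: measurability, the decomposition
`φ i = ∑ v, lam i v * φv i v` on `Y`, and the fact that, before the exit time and as long as no
point is added, all the `φv i v` stay below the bound computed at the last time. -/
structure Admissible (lam : ∀ i, PMF (V i)) (φv : ∀ i, V i → PastConfig I → ℝ≥0)
    (φ : I → PastConfig I → ℝ≥0) (Γ : I → Config I → ℝ → ℝ≥0) (Y : Set (PastConfig I))
    (tmax : ℝ) : Prop where
  countable : ∀ i, Countable (V i)
  tmax_pos : 0 < tmax
  measurable_part : ∀ i v, Measurable (φv i v)
  measurable_intensity : ∀ i, Measurable (φ i)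
  measurable_bound : ∀ i, Measurable fun p : Config I × ℝ => Γ i p.1 p.2
  measurable_exitTime : Measurable (exitTime Y tmax)
  tsum_eq : ∀ i, ∀ x ∈ Y, ∑' v, lam i v * (φv i v x : ℝ≥0∞) = φ i x
  part_le : ∀ (X : Config I) (T u : ℝ), 0 ≤ T → (∀ i, X.pts i ⊆ Ioc 0 T) → T < u →
    u < exitTime Y tmax X → ∀ i v, φv i v (X.past u) ≤ Γ i X T

variable {lam : ∀ i, PMF (V i)} {φv : ∀ i, V i → PastConfig I → ℝ≥0}
  {φ : I → PastConfig I → ℝ≥0} {Γ : I → Config I → ℝ → ℝ≥0} {Y : Set (PastConfig I)}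
  {tmax : ℝ} {Nmax : ℕ}

theorem Admissible.intensity_le (h : Admissible lam φv φ Γ Y tmax) {X : Config I} {T u : ℝ}
    (hT : 0 ≤ T) (hX : ∀ i, X.pts i ⊆ Ioc 0 T) (hu : T < u) (huτ : u < exitTime Y tmax X)
    (i : I) : (φ i (X.past u) : ℝ≥0∞) ≤ Γ i X T := by
  rw [← h.tsum_eq i _ (past_mem_of_lt_exitTime h.tmax_pos (hT.trans hu.le) huτ)]
  calc ∑' v, lam i v * (φv i v (X.past u) : ℝ≥0∞)
      ≤ ∑' v, lam i v * (Γ i X T : ℝ≥0∞) := by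
        refine ENNReal.tsum_le_tsum fun v => ?_
        gcongr
        exact h.part_le X T u hT hX hu huτ i v
    _ = Γ i X T := by rw [ENNReal.tsum_mul_right, (lam i).tsum_coe, one_mul]

theorem Config.insert_pts_subset {x : Config I} {i j : I} {t : ℝ} :
    (x.insert i t).pts j ⊆ x.pts j ∪ {t} := by
  rintro s (hs | hs)
  · exact Or.inl hs
  · exact Or.inr hs.2.1

theorem State.toReal_T_le_exitTime (htmax : 0 < tmax) {s : State I}
    (hs : s.Active Y tmax Nmax) : s.T.toReal ≤ exitTime Y tmax s.X :=
  ENNReal.toReal_le_of_le_ofReal (exitTime_nonneg htmax) hs.1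

/-- On the states that continue `x` beyond time `a` without new points up to `a`, an event `A` of
the history at time `a` is constant; its value is read off in the state `(x, ∞, 0)`. -/
theorem State.indicator_history_eq (htmax : 0 < tmax) {a : ℝ} {A : Set (State I)}
    (hA : MeasurableSet[history State.X (State.horizon Y tmax) a] A) {x : Config I}
    {s : State I} (hH : s.horizon Y tmax ≤ exitTime Y tmax x)
    (hp : ∀ j, ∀ p < s.horizon Y tmax, p ∈ s.X.pts j ↔ p ∈ x.pts j) {F : State I → ℝ≥0∞}
    (hF : s.horizon Y tmax ≤ a → F s = 0) :
    A.indicator F s = A.indicator 1 ((x, ∞, 0) : State I) * F s := by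
  rcases le_or_gt (s.horizon Y tmax) a with h | h
  · rw [hF h, mul_zero, indicator_apply_eq_zero]
    exact fun _ => hF h
  · have h1 : s ∈ A ↔ ((x, ∞, 0) : State I) ∈ A := by
      refine mem_iff_of_measurableSet_history hA h ?_ fun j p hpa => hp j p (hpa.trans_lt h)
      rw [State.horizon_of_exitTime_lt htmax _ ENNReal.ofReal_lt_top]
      exact h.trans_le hH
    by_cases hs : s ∈ A
    · rw [indicator_of_mem hs, indicator_of_mem (h1.1 hs), Pi.one_apply, one_mul]
    · rw [indicator_of_notMem hs, indicator_of_notMem (fun h' => hs (h1.2 h')), zero_mul]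

/-- Until the exit time, the integrated intensity along a path without further points is finite,
since the intensity is bounded by `Γ`. -/
theorem Admissible.lintegral_intensity_lt_top (h : Admissible lam φv φ Γ Y tmax) {X : Config I}
    {T : ℝ} (hT : 0 ≤ T) (hX : ∀ i, X.pts i ⊆ Ioc 0 T) (i : I) (a b t : ℝ) :
    ∫⁻ u in Ioc T t, (Ioc a b ∩ Iic (exitTime Y tmax X)).indicator
      (fun u => (φ i (X.past u) : ℝ≥0∞)) u < ∞ := by
  rw [setLIntegral_indicator (measurableSet_Ioc.inter measurableSet_Iic)]
  calc _ ≤ ∫⁻ u in Ioc T (exitTime Y tmax X), (φ i (X.past u) : ℝ≥0∞) :=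
        lintegral_mono_set fun u hu => ⟨hu.2.1, hu.1.2⟩
    -- The past before the exit time itself may lie outside `Y`, where `φ i` is not bounded.
    _ = ∫⁻ u in Ioo T (exitTime Y tmax X), (φ i (X.past u) : ℝ≥0∞) :=
        (setLIntegral_congr Ioo_ae_eq_Ioc).symm
    _ ≤ ∫⁻ u in Ioo T (exitTime Y tmax X), (Γ i X T : ℝ≥0∞) :=
        setLIntegral_mono' measurableSet_Ioo fun u hu => h.intensity_le hT hX hu.1 hu.2 i
    _ < ∞ := by
        rw [setLIntegral_const, Real.volume_Ioo]
        exact ENNReal.mul_lt_top ENNReal.coe_lt_top ENNReal.ofReal_lt_top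

variable [Fintype I]

/-- A proposed time `u` becomes a point of component `i` with probability `φ i / r`, where `r` is
the total rate of the proposals. -/
theorem Admissible.acceptance_probability (h : Admissible lam φv φ Γ Y tmax) {X : Config I}
    {T u : ℝ} (hT : 0 ≤ T) (hX : ∀ i, X.pts i ⊆ Ioc 0 T) (hu : T < u)
    (huτ : u < exitTime Y tmax X) (hr : ∑ j, Γ j X T ≠ 0) (i : I) :
    ((Γ i X T / ∑ j, Γ j X T : ℝ≥0) : ℝ≥0∞) *
        ∑' v : V i, lam i v * ((min 1 (φv i v (X.past u) / Γ i X T) : ℝ≥0) : ℝ≥0∞) =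
      ((∑ j, Γ j X T : ℝ≥0) : ℝ≥0∞)⁻¹ * φ i (X.past u) := by
  -- If the bound of component `i` is zero, the index `i` is never chosen, and `φ i` vanishes too.
  by_cases hg : Γ i X T = 0
  · have h0 := h.intensity_le hT hX hu huτ i
    rw [hg, ENNReal.coe_zero, nonpos_iff_eq_zero] at h0
    rw [h0, hg]
    simp
  · rw [← h.tsum_eq i _ (past_mem_of_lt_exitTime h.tmax_pos (hT.trans hu.le) huτ),
      ← ENNReal.tsum_mul_left, ← ENNReal.tsum_mul_left]
    refine tsum_congr fun v => ?_
    rw [min_eq_right (div_le_one_of_le₀ (h.part_le X T u hT hX hu huτ i v) zero_le),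
      ENNReal.coe_div hr, ENNReal.coe_div hg, div_eq_mul_inv, div_eq_mul_inv]
    have h1 : (Γ i X T : ℝ≥0∞) * (Γ i X T : ℝ≥0∞)⁻¹ = 1 :=
      ENNReal.mul_inv_cancel (by simpa using hg) ENNReal.coe_ne_top
    calc _ = (Γ i X T : ℝ≥0∞) * (Γ i X T : ℝ≥0∞)⁻¹ * (((∑ j, Γ j X T : ℝ≥0) : ℝ≥0∞)⁻¹ *
          (lam i v * φv i v (X.past u))) := by ring
      _ = _ := by rw [h1, one_mul]

/-- The invariant of the loop after `n` runs: the points lie in `(0, H]`, the compensators are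
finite, and `n` points have been proposed unless the exit time has been passed. -/
structure State.Valid (φ : I → PastConfig I → ℝ≥0) (Y : Set (PastConfig I)) (tmax : ℝ) (n : ℕ)
    (s : State I) : Prop where
  pts_subset : ∀ i, s.X.pts i ⊆ Ioc 0 (s.horizon Y tmax)
  compensator_lt_top : ∀ i, s.compensator φ Y tmax i 0 tmax < ∞
  steps_eq : s.T ≤ ENNReal.ofReal (exitTime Y tmax s.X) → s.N = n

theorem Admissible.measurableSet_valid (h : Admissible lam φv φ Γ Y tmax) (n : ℕ) :
    MeasurableSet {s : State I | s.Valid φ Y tmax n} := by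
  have h1 : {s : State I | s.Valid φ Y tmax n} =
      (⋂ i, {s | s.X.pts i ⊆ Ioc 0 (s.horizon Y tmax)}) ∩
      (⋂ i, {s | s.compensator φ Y tmax i 0 tmax < ∞}) ∩
      ({s | s.T ≤ ENNReal.ofReal (exitTime Y tmax s.X)}ᶜ ∪ {s | s.N = n}) := by
    ext s
    simp only [mem_inter_iff, mem_iInter, mem_union, mem_compl_iff, mem_ofPred_eq]
    exact ⟨fun h => ⟨⟨h.1, h.2⟩, imp_iff_not_or.1 h.3⟩, fun h => ⟨h.1.1, h.1.2,
      imp_iff_not_or.2 h.2⟩⟩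
  rw [h1]
  have hτ := h.measurable_exitTime
  refine ((MeasurableSet.iInter fun i => ?_).inter (MeasurableSet.iInter fun i => ?_)).inter
    (MeasurableSet.union (MeasurableSet.compl ?_) ?_)
  · exact Config.measurableSet_pts_subset i State.measurable_X (State.measurable_horizon hτ)
  · exact State.measurable_compensator hτ (h.measurable_intensity i) 0 tmax measurableSet_Iio
  · exact measurableSet_le State.measurable_T (hτ.comp State.measurable_X).ennreal_ofReal
  · exact State.measurable_N (measurableSet_singleton n)

theorem Admissible.ae_step_valid (h : Admissible lam φv φ Γ Y tmax) {n : ℕ} (hn : n ≤ Nmax)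
    {s : State I} (hv : s.Valid φ Y tmax n) :
    ∀ᵐ s' ∂step lam φv Γ Y tmax Nmax s, s'.Valid φ Y tmax (n + 1) := by
  have := h.countable
  have htmax := h.tmax_pos
  have hB := h.measurableSet_valid (n + 1)
  by_cases hs : s.Active Y tmax Nmax
  swap
  · rw [step_of_not_active hs]
    refine (ae_dirac_iff hB).2 ⟨hv.1, hv.2, fun hT => ?_⟩
    exact absurd ⟨hT, (hv.3 hT).trans_le hn⟩ hs
  have hH := State.horizon_eq_toReal hs.1
  have hT0 : 0 ≤ s.T.toReal := ENNReal.toReal_nonneg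
  have hTτ := State.toReal_T_le_exitTime htmax hs
  have hX : ∀ i, s.X.pts i ⊆ Ioc 0 s.T.toReal := fun i => hH ▸ hv.1 i
  -- In all the cases the new horizon has the form `τ ∧ t`, with `t = τ` at the end of the loop.
  have key (s' : State I) (t : ℝ) (hH' : s'.horizon Y tmax = min (exitTime Y tmax s.X) t)
      (ht : s.T.toReal ≤ t) (hpast : ∀ u ≤ t, s'.X.past u = s.X.past u)
      (hpts : ∀ i, s'.X.pts i ⊆ Ioc 0 (min (exitTime Y tmax s.X) t))
      (hN : s'.T ≤ ENNReal.ofReal (exitTime Y tmax s'.X) → s'.N = n + 1) :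
      s'.Valid φ Y tmax (n + 1) := by
    refine ⟨fun i => hH' ▸ hpts i, fun i => ?_, hN⟩
    rw [State.compensator_eq_add hH hH' (le_min hTτ ht)
      fun u hu => hpast u (hu.trans (min_le_right _ _))]
    exact ENNReal.add_lt_top.2 ⟨hv.2 i, h.lintegral_intensity_lt_top hT0 hX i _ _ _⟩
  refine ae_step h.measurable_part h.measurable_bound h.measurable_exitTime hs hB ?_ ?_ ?_
  · intro t ht
    refine key _ (exitTime Y tmax s.X) ?_ hTτ (fun _ _ => rfl) (fun i => ?_)
      fun hle => absurd ht (not_lt.2 hle)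
    · rw [State.horizon_of_exitTime_lt htmax _ ht, min_self]
    · rw [min_self]
      exact (hX i).trans (Ioc_subset_Ioc_right hTτ)
  · intro t ht htτ
    refine key _ t ?_ ht.le (fun _ _ => rfl) (fun i => ?_) fun _ => congrArg (· + 1) (hv.3 hs.1)
    · rw [State.horizon_of_le_exitTime _ (hT0.trans ht.le) htτ, min_eq_right htτ]
    · rw [min_eq_right htτ]
      exact (hX i).trans (Ioc_subset_Ioc_right ht.le)
  · intro t ht htτ j
    refine key _ t ?_ ht.le (fun u hu => Config.past_insert _ _ hu) (fun i => ?_)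
      fun _ => congrArg (· + 1) (hv.3 hs.1)
    · rw [State.horizon_of_le_exitTime _ (hT0.trans ht.le) (le_exitTime_insert htmax j htτ),
        min_eq_right htτ]
    · rw [min_eq_right htτ]
      refine Config.insert_pts_subset.trans (union_subset
        ((hX i).trans (Ioc_subset_Ioc_right ht.le)) ?_)
      exact singleton_subset_iff.2 ⟨hT0.trans_lt ht, le_rfl⟩

end Loop

section Increment

variable {I : Type*} [Fintype I] {V : I → Set (Set (I × ℝ))}
  {lam : ∀ i, PMF (V i)} {φv : ∀ i, V i → PastConfig I → ℝ≥0}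
  {φ : I → PastConfig I → ℝ≥0} {Γ : I → Config I → ℝ → ℝ≥0} {Y : Set (PastConfig I)}
  {tmax : ℝ} {Nmax : ℕ}

/-- If, given that the next proposed time is `T + e`, the mean of `f` is its old value plus
`c * ξ e`, then the mean of `f` after one run of the loop is its old value plus the mean of
`c * ξ`. -/
theorem Admissible.lintegral_step_eq_add (h : Admissible lam φv φ Γ Y tmax) {s : State I}
    (hs : s.Active Y tmax Nmax) {r : ℝ≥0} (hrs : ∑ i, Γ i s.X s.T.toReal = r) (hr : r ≠ 0)
    {f : State I → ℝ≥0∞} (hf : Measurable f) {c : ℝ≥0∞} (hc : c ≠ ∞) {ξ : ℝ → ℝ≥0∞}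
    (hend : ∀ t, s.T.toReal < t → exitTime Y tmax s.X < t →
      f (s.X, ENNReal.ofReal t, s.N) = f s + c * ξ t)
    (hprop : ∀ t, s.T.toReal < t → t < exitTime Y tmax s.X →
      ∫⁻ x, f (x, ENNReal.ofReal t, s.N + 1)
        ∂thinning lam φv (fun i => Γ i s.X s.T.toReal) s.X t = f s + c * ξ t) :
    ∫⁻ s', f s' ∂step lam φv Γ Y tmax Nmax s = f s +
      c * ∫⁻ e in Ioi (0 : ℝ), ENNReal.ofReal (r * Real.exp (-(r * e))) *
        ξ (s.T.toReal + e) := by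
  have := h.countable
  have hw : Measurable fun e : ℝ => ENNReal.ofReal (r * Real.exp (-(r * e))) := by fun_prop
  have key : ∀ᵐ e ∂volume.restrict (Ioi (0 : ℝ)),
      (ENNReal.ofReal (r * Real.exp (-(r * e))) *
        if exitTime Y tmax s.X < s.T.toReal + e then
          f (s.X, ENNReal.ofReal (s.T.toReal + e), s.N)
        else ∫⁻ x, f (x, ENNReal.ofReal (s.T.toReal + e), s.N + 1)
          ∂thinning lam φv (fun i => Γ i s.X s.T.toReal) s.X (s.T.toReal + e)) =
      ENNReal.ofReal (r * Real.exp (-(r * e))) * f s +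
        c * (ENNReal.ofReal (r * Real.exp (-(r * e))) * ξ (s.T.toReal + e)) := by
    -- The decomposition of `φ i` need not hold at the exit time, which is proposed with
    -- probability zero.
    have hne : ∀ᵐ e : ℝ, e ≠ exitTime Y tmax s.X - s.T.toReal :=
      compl_mem_ae_iff.2 (measure_singleton _)
    filter_upwards [ae_restrict_mem measurableSet_Ioi, ae_restrict_of_ae hne] with e he hne
    have ht : s.T.toReal < s.T.toReal + e := lt_add_of_pos_right _ he
    split_ifs with hτ
    · rw [hend _ ht hτ]
      ring
    · rw [hprop _ ht (lt_of_le_of_ne (not_lt.1 hτ) fun h' => hne (by linarith))]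
      ring
  rw [lintegral_step_of_rate_ne_zero h.measurable_part h.measurable_bound h.measurable_exitTime
    hs hrs hr hf, lintegral_congr_ae key, lintegral_add_left (hw.mul_const _),
    lintegral_mul_const _ hw, lintegral_exp_density hr, one_mul, lintegral_const_mul' _ _ hc]

/-- One run of the loop increases the mean of the number of points on an event of the history by the
same amount as the mean of the compensator on this event. -/
theorem Admissible.exists_step_increment (h : Admissible lam φv φ Γ Y tmax) {n : ℕ}
    {s : State I} (hv : s.Valid φ Y tmax n) (i : I) (a b : ℝ) {A : Set (State I)}
    (hA : MeasurableSet[history State.X (State.horizon Y tmax) a] A) :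
    ∃ k, ∫⁻ s', A.indicator (State.countUpTo Y tmax i a b) s' ∂step lam φv Γ Y tmax Nmax s =
        A.indicator (State.countUpTo Y tmax i a b) s + k ∧
      ∫⁻ s', A.indicator (State.compensator φ Y tmax i a b) s' ∂step lam φv Γ Y tmax Nmax s =
        A.indicator (State.compensator φ Y tmax i a b) s + k := by
  classical
  have := h.countable
  have htmax := h.tmax_pos
  have hτm := h.measurable_exitTime
  have hAm : MeasurableSet A := history_le State.measurable_X (State.measurable_horizon hτm) A hA
  have hCm := (State.measurable_countUpTo hτm i a b).indicator hAm
  have hDm := (State.measurable_compensator hτm (h.measurable_intensity i) a b).indicator hAm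
  by_cases hs : s.Active Y tmax Nmax
  swap
  · refine ⟨0, ?_, ?_⟩
    · rw [step_of_not_active hs, lintegral_dirac' _ hCm, add_zero]
    · rw [step_of_not_active hs, lintegral_dirac' _ hDm, add_zero]
  have hH := State.horizon_eq_toReal hs.1
  have hT0 : 0 ≤ s.T.toReal := ENNReal.toReal_nonneg
  have hTτ := State.toReal_T_le_exitTime htmax hs
  have hX : ∀ i, s.X.pts i ⊆ Ioc 0 s.T.toReal := fun i => hH ▸ hv.1 i
  set c : ℝ≥0∞ := A.indicator 1 ((s.X, ∞, 0) : State I) with hc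
  have hc_top : c ≠ ∞ := by
    rw [hc, indicator_apply]
    split_ifs <;> simp
  set ψ : ℝ → ℝ≥0∞ := (Ioc a b ∩ Iic (exitTime Y tmax s.X)).indicator
    (fun u => (φ i (s.X.past u) : ℝ≥0∞)) with hψ
  have hψm : Measurable ψ := (measurable_intensity_past (h.measurable_intensity i) s.X).indicator
    (measurableSet_Ioc.inter measurableSet_Iic)
  have hψτ (t : ℝ) (ht : exitTime Y tmax s.X < t) : ψ t = 0 :=
    indicator_of_notMem (fun h' => absurd h'.2 (not_le.2 ht)) _
  -- The indicator of `A` can be replaced by `c` in all the states that are considered.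
  have hcC (s' : State I) (h1 : s'.horizon Y tmax ≤ exitTime Y tmax s.X)
      (h2 : ∀ j, ∀ p < s'.horizon Y tmax, p ∈ s'.X.pts j ↔ p ∈ s.X.pts j) :
      A.indicator (State.countUpTo Y tmax i a b) s' = c * s'.countUpTo Y tmax i a b :=
    State.indicator_history_eq htmax hA h1 h2 fun h' => State.countUpTo_of_horizon_le h' i b
  have hcD (s' : State I) (h1 : s'.horizon Y tmax ≤ exitTime Y tmax s.X)
      (h2 : ∀ j, ∀ p < s'.horizon Y tmax, p ∈ s'.X.pts j ↔ p ∈ s.X.pts j) :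
      A.indicator (State.compensator φ Y tmax i a b) s' = c * s'.compensator φ Y tmax i a b :=
    State.indicator_history_eq htmax hA h1 h2 fun h' => State.compensator_of_horizon_le h' i b
  have hCs := hcC s (hH.trans_le hTτ) fun _ _ _ => Iff.rfl
  have hDs := hcD s (hH.trans_le hTτ) fun _ _ _ => Iff.rfl
  have hcount : s.countUpTo Y tmax i a b = s.X.count i (Ioc a b) :=
    State.countUpTo_eq (fun p hp => (hv.1 i hp).2) a b
  -- States in which the exit time has been passed.
  have hend_hor {t : ℝ≥0∞} (ht : ENNReal.ofReal (exitTime Y tmax s.X) < t) :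
      State.horizon Y tmax (s.X, t, s.N) = exitTime Y tmax s.X :=
    State.horizon_of_exitTime_lt htmax _ ht
  have hendC {t : ℝ≥0∞} (ht : ENNReal.ofReal (exitTime Y tmax s.X) < t) :
      A.indicator (State.countUpTo Y tmax i a b) (s.X, t, s.N) =
        A.indicator (State.countUpTo Y tmax i a b) s := by
    rw [hCs, hcC _ (hend_hor ht).le fun _ _ _ => Iff.rfl, hcount, State.countUpTo_eq]
    · rfl
    · rw [hend_hor ht]
      exact fun p hp => ((hX i hp).2.trans hTτ)
  have hendD {t : ℝ≥0∞} (ht : ENNReal.ofReal (exitTime Y tmax s.X) < t) {t' : ℝ}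
      (ht' : exitTime Y tmax s.X ≤ t') :
      A.indicator (State.compensator φ Y tmax i a b) (s.X, t, s.N) =
        A.indicator (State.compensator φ Y tmax i a b) s +
          c * ∫⁻ u in Ioc s.T.toReal t', ψ u := by
    rw [hDs, hcD _ (hend_hor ht).le fun _ _ _ => Iff.rfl, ← mul_add]
    congr 1
    exact State.compensator_eq_add hH ((hend_hor ht).trans (min_eq_left ht').symm)
      (le_min hTτ (hTτ.trans ht')) (fun _ _ => rfl) a b
  by_cases hr : ∑ i, Γ i s.X s.T.toReal = 0
  · refine ⟨0, ?_, ?_⟩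
    · rw [lintegral_step_of_rate_eq_zero h.measurable_part h.measurable_bound hτm hs hr hCm,
        hendC ENNReal.ofReal_lt_top, add_zero]
    · rw [lintegral_step_of_rate_eq_zero h.measurable_part h.measurable_bound hτm hs hr hDm,
        hendD ENNReal.ofReal_lt_top le_rfl, ← setLIntegral_congr Ioo_ae_eq_Ioc,
        setLIntegral_congr_fun (g := fun _ => 0) measurableSet_Ioo, lintegral_zero, mul_zero]
      intro u hu
      have h1 := h.intensity_le hT0 hX hu.1 hu.2 i
      rw [(Finset.sum_eq_zero_iff.1 hr) i (Finset.mem_univ i), ENNReal.coe_zero,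
        nonpos_iff_eq_zero] at h1
      exact indicator_apply_eq_zero.2 fun _ => h1
  obtain ⟨r, hrs⟩ : ∃ r, ∑ i, Γ i s.X s.T.toReal = r := ⟨_, rfl⟩
  have hr' : r ≠ 0 := hrs ▸ hr
  -- States after a proposal at time `t`.
  have hprop_hor {x : Config I} {t : ℝ} (ht : s.T.toReal < t) (hx : t ≤ exitTime Y tmax x) :
      State.horizon Y tmax (x, ENNReal.ofReal t, s.N + 1) = t :=
    State.horizon_of_le_exitTime _ (hT0.trans ht.le) hx
  have hins {t : ℝ} (j : I) (k : I) (p : ℝ) (hp : p < t) :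
      p ∈ (s.X.insert j t).pts k ↔ p ∈ s.X.pts k :=
    ⟨fun h' => h'.resolve_right fun h'' => hp.ne h''.2.1, fun h' => Or.inl h'⟩
  have hpropD {x : Config I} {t : ℝ} (ht : s.T.toReal < t) (htτ : t ≤ exitTime Y tmax s.X)
      (hx : t ≤ exitTime Y tmax x) (hp : ∀ j, ∀ p < t, p ∈ x.pts j ↔ p ∈ s.X.pts j) :
      A.indicator (State.compensator φ Y tmax i a b) (x, ENNReal.ofReal t, s.N + 1) =
        A.indicator (State.compensator φ Y tmax i a b) s +
          c * ∫⁻ u in Ioc s.T.toReal t, ψ u := by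
    rw [hDs, hcD _ ((hprop_hor ht hx).trans_le htτ) (by rw [hprop_hor ht hx]; exact hp),
      ← mul_add]
    congr 1
    refine State.compensator_eq_add hH ((hprop_hor ht hx).trans (min_eq_right htτ).symm)
      (le_min hTτ ht.le) (fun u hu => Config.past_congr fun j p hpu => hp j p ?_) a b
    exact hpu.trans_le (hu.trans (min_le_right _ _))
  have hpropC {x : Config I} {t : ℝ} (ht : s.T.toReal < t) (htτ : t ≤ exitTime Y tmax s.X)
      (hx : t ≤ exitTime Y tmax x) (hp : ∀ j, ∀ p < t, p ∈ x.pts j ↔ p ∈ s.X.pts j)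
      (hpt : x.pts i ⊆ Iic t) :
      A.indicator (State.countUpTo Y tmax i a b) (x, ENNReal.ofReal t, s.N + 1) =
        c * x.count i (Ioc a b) := by
    rw [hcC _ ((hprop_hor ht hx).trans_le htτ) (by rw [hprop_hor ht hx]; exact hp),
      State.countUpTo_eq]
    · rfl
    · rw [hprop_hor ht hx]
      exact hpt
  have hm (t : ℝ) : Measurable fun x : Config I => ((x, ENNReal.ofReal t, s.N + 1) : State I) := by
    fun_prop
  refine ⟨c * ∫⁻ e in Ioi (0 : ℝ), ENNReal.ofReal (r * Real.exp (-(r * e))) *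
      ((r : ℝ≥0∞)⁻¹ * ψ (s.T.toReal + e)), ?_, ?_⟩
  · refine h.lintegral_step_eq_add hs hrs hr' hCm hc_top (ξ := fun t => (r : ℝ≥0∞)⁻¹ * ψ t)
      (fun t ht hτt => ?_) (fun t ht htτ => ?_)
    · rw [hendC ((ENNReal.ofReal_lt_ofReal_iff (hT0.trans_lt ht)).2 hτt), hψτ t hτt]
      simp
    · have hptX : s.X.pts i ⊆ Iic t := fun p hp => (hX i hp).2.trans ht.le
      have hf0 : A.indicator (State.countUpTo Y tmax i a b)
          (s.X, ENNReal.ofReal t, s.N + 1) = A.indicator (State.countUpTo Y tmax i a b) s := by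
        rw [hpropC ht htτ.le htτ.le (fun _ _ _ => Iff.rfl) hptX, hCs, hcount]
      rw [lintegral_thinning_of_add hr (f := fun x => A.indicator (State.countUpTo Y tmax i a b)
        ((x, ENNReal.ofReal t, s.N + 1) : State I)) (hCm.comp (hm t))
        (δ := fun j => if i = j then c * (Ioc a b).indicator 1 t else 0), hf0]
      · congr 1
        rw [Finset.sum_eq_single i (fun j _ hj => by rw [if_neg hj.symm, mul_zero, mul_zero])
          (fun h' => absurd (Finset.mem_univ i) h'), if_pos rfl, ← mul_assoc,
          h.acceptance_probability hT0 hX ht htτ hr i, hrs, hψ, indicator_apply, indicator_apply]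
        by_cases hab : t ∈ Ioc a b
        · rw [if_pos hab, if_pos ⟨hab, htτ.le⟩, Pi.one_apply]
          ring
        · rw [if_neg hab, if_neg fun h' => hab h'.1]
          ring
      · intro j
        have htn : ∀ k, t ∉ s.X.pts k := fun k hk => absurd (hX k hk).2 (not_le.2 ht)
        rw [hpropC ht htτ.le (le_exitTime_insert htmax j htτ.le)
          (fun k p hp => hins j k p hp) (Config.insert_pts_subset.trans
            (union_subset hptX (singleton_subset_iff.2 self_mem_Iic))), hf0, hCs, hcount,
          Config.count_insert _ _ _ _ a b Ioc_subset_Icc_self]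
        by_cases hij : i = j
        · by_cases hab : t ∈ Ioc a b
          · rw [if_pos ⟨hij, hab, htn⟩, if_pos hij, indicator_of_mem hab]
            push_cast
            rw [mul_add, Pi.one_apply]
          · rw [if_neg fun h' => hab h'.2.1, if_pos hij, indicator_of_notMem hab]
            simp
        · rw [if_neg fun h' => hij h'.1, if_neg hij]
          simp
  · rw [← lintegral_exp_density_mul_lintegral hr' _ hψm]
    refine h.lintegral_step_eq_add hs hrs hr' hDm hc_top
      (ξ := fun t => ∫⁻ u in Ioc s.T.toReal t, ψ u) (fun t ht hτt => ?_) (fun t ht htτ => ?_)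
    · exact hendD ((ENNReal.ofReal_lt_ofReal_iff (hT0.trans_lt ht)).2 hτt) hτt.le
    · rw [lintegral_thinning_of_const hr (f := fun x =>
        A.indicator (State.compensator φ Y tmax i a b)
          ((x, ENNReal.ofReal t, s.N + 1) : State I)) (hDm.comp (hm t))]
      · exact hpropD ht htτ.le htτ.le fun _ _ _ => Iff.rfl
      · intro j
        rw [hpropD ht htτ.le htτ.le fun _ _ _ => Iff.rfl,
          hpropD ht htτ.le (le_exitTime_insert htmax j htτ.le) fun k p hp => hins j k p hp]

/-! ### The law of the final state -/

/-- The bound on `n` is needed: once `N` exceeds `Nmax`, further runs leave `N` unchanged. -/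
theorem Admissible.ae_stateLaw_valid (h : Admissible lam φv φ Γ Y tmax) {n : ℕ}
    (hn : n ≤ Nmax + 1) :
    ∀ᵐ s ∂stateLaw lam φv Γ Y tmax Nmax n, s.Valid φ Y tmax n := by
  have := h.countable
  induction n with
  | zero =>
    refine (ae_dirac_iff (h.measurableSet_valid 0)).2 ⟨fun i => empty_subset _, fun i => ?_,
      fun _ => rfl⟩
    rw [State.compensator_of_horizon_le]
    · exact ENNReal.zero_lt_top
    · exact (State.horizon_eq_toReal zero_le).le
  | succ n ih =>
    have hm := measurable_step (lam := lam) (Nmax := Nmax) h.measurable_part h.measurable_bound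
      h.measurable_exitTime
    have hB := (h.measurableSet_valid (n + 1)).compl
    rw [ae_iff]
    change stateLaw lam φv Γ Y tmax Nmax (n + 1) {s | s.Valid φ Y tmax (n + 1)}ᶜ = 0
    rw [stateLaw, Measure.bind_apply hB hm.aemeasurable]
    exact (lintegral_congr_ae ((ih (by omega)).mono fun s hs =>
      h.ae_step_valid (by omega) hs)).trans lintegral_zero

/-- The intensity identity after `n` runs of the loop. Both sides vanish at the beginning, and each
run adds the same amount to both. -/
theorem Admissible.lintegral_count_eq_lintegral_compensator
    (h : Admissible lam φv φ Γ Y tmax) {n : ℕ} (hn : n ≤ Nmax + 1) (i : I)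
    {a : ℝ} (ha : 0 ≤ a) (b : ℝ) {A : Set (State I)}
    (hA : MeasurableSet[history State.X (State.horizon Y tmax) a] A) :
    ∫⁻ s, A.indicator (State.countUpTo Y tmax i a b) s ∂stateLaw lam φv Γ Y tmax Nmax n =
      ∫⁻ s, A.indicator (State.compensator φ Y tmax i a b) s
        ∂stateLaw lam φv Γ Y tmax Nmax n := by
  have := h.countable
  have hτm := h.measurable_exitTime
  have hAm : MeasurableSet A := history_le State.measurable_X (State.measurable_horizon hτm) A hA
  have hCm := (State.measurable_countUpTo hτm i a b).indicator hAm
  have hDm := (State.measurable_compensator hτm (h.measurable_intensity i) a b).indicator hAm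
  induction n with
  | zero =>
    classical
    have h0 : State.horizon Y tmax ((Config.empty I, 0, 0) : State I) ≤ a :=
      (State.horizon_eq_toReal zero_le).le.trans ha
    rw [stateLaw, lintegral_dirac' _ hCm, lintegral_dirac' _ hDm, indicator_apply,
      indicator_apply, State.countUpTo_of_horizon_le h0, State.compensator_of_horizon_le h0]
  | succ n ih =>
    have hm := measurable_step (lam := lam) (Nmax := Nmax) h.measurable_part h.measurable_bound
      h.measurable_exitTime
    have hk (s : State I) : ∃ k, s.Valid φ Y tmax n →
        ∫⁻ s', A.indicator (State.countUpTo Y tmax i a b) s' ∂step lam φv Γ Y tmax Nmax s =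
          A.indicator (State.countUpTo Y tmax i a b) s + k ∧
        ∫⁻ s', A.indicator (State.compensator φ Y tmax i a b) s'
            ∂step lam φv Γ Y tmax Nmax s =
          A.indicator (State.compensator φ Y tmax i a b) s + k := by
      by_cases hv : s.Valid φ Y tmax n
      · obtain ⟨k, hk⟩ := h.exists_step_increment (Nmax := Nmax) hv i a b hA
        exact ⟨k, fun _ => hk⟩
      · exact ⟨0, fun h' => absurd h' hv⟩
    -- The increment `k` need not be measurable: in `lintegral_add_left` only the first summand is
    -- required to be so.
    choose k hk using hk
    have hv := h.ae_stateLaw_valid (Nmax := Nmax) (n := n) (by omega)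
    rw [stateLaw, Measure.lintegral_bind hm.aemeasurable hCm.aemeasurable,
      Measure.lintegral_bind hm.aemeasurable hDm.aemeasurable,
      lintegral_congr_ae (hv.mono fun s hs => (hk s hs).1),
      lintegral_congr_ae (hv.mono fun s hs => (hk s hs).2), lintegral_add_left hCm,
      lintegral_add_left hDm, ih (by omega)]

end Increment

end KalikowForward

open KalikowForward in
theorem mainTheorem10 {I : Type*} [Fintype I]
    (V : I → Set (Set (I × ℝ)))
    (hVcount : ∀ i, (V i).Countable)
    (hVfin : ∀ i, ∀ v ∈ V i, IsFiniteNeighborhood v)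
    (Y : Set (PastConfig I))
    (φ : I → PastConfig I → ℝ≥0)
    (hφ : ∀ i, Measurable (φ i))
    (Δ : ∀ i, V i → PastConfig I → ℝ≥0)
    (hΔ : ∀ i v, Measurable (Δ i v))
    (hΔcyl : ∀ i (v : V i), IsCylindrical (v : Set (I × ℝ)) (Δ i v))
    (hΔsum : ∀ i, ∀ x ∈ Y, HasSum (fun v => Δ i v x) (φ i x))
    (lam : ∀ i, PMF (V i))
    (hlam : ∀ i v, lam i v = 0 → ∀ x ∈ Y, Δ i v x = 0)
    (hmono : ∀ i v, ∀ t : ℝ, 0 ≤ t → ∀ x, kalikow lam Δ i v (x.shift t) ≤ kalikow lam Δ i v x)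
    (tmax : ℝ) (htmax : 0 < tmax) (Nmax : ℕ)
    (hτ : Measurable (exitTime Y tmax))
    (Γ : I → Config I → ℝ → ℝ≥0)
    (hΓ : ∀ i, Measurable fun p : Config I × ℝ => Γ i p.1 p.2)
    (hΓbound : ∀ (X : Config I) (T : ℝ), 0 ≤ T → (∀ i, X.pts i ⊆ Ioc 0 T) →
      T < exitTime Y tmax X → ∀ i v, ∀ᶠ s in 𝓝[>] T, kalikow lam Δ i v (X.past s) ≤ Γ i X T) :
    (∀ i, ∀ x ∈ Y, HasSum (fun v => (lam i v).toNNReal * kalikow lam Δ i v x) (φ i x)) ∧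
    IsProbabilityMeasure (outputLaw lam (kalikow lam Δ) Γ Y tmax Nmax) ∧
    (∀ᵐ s ∂(outputLaw lam (kalikow lam Δ) Γ Y tmax Nmax),
      ¬ (s.T ≤ ENNReal.ofReal (exitTime Y tmax s.X) ∧ s.N ≤ Nmax)) ∧
    HasGenericIntensityUpTo (outputLaw lam (kalikow lam Δ) Γ Y tmax Nmax)
      State.X (State.horizon Y tmax) φ := by
  have h : Admissible lam (kalikow lam Δ) φ Γ Y tmax :=
    { countable := fun i => (hVcount i).to_subtype
      tmax_pos := htmax
      measurable_part := fun i v => (hΔ i v).div_const _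
      measurable_intensity := hφ
      measurable_bound := hΓ
      measurable_exitTime := hτ
      tsum_eq := tsum_kalikow hΔsum hlam
      part_le := fun X T u hT hX hu huτ i v =>
        kalikow_past_le hmono hΓbound hT hX (hu.trans huτ) hu i v }
  have := h.countable
  have hv : ∀ᵐ s ∂(outputLaw lam (kalikow lam Δ) Γ Y tmax Nmax),
      s.Valid φ Y tmax (Nmax + 1) := h.ae_stateLaw_valid le_rfl
  refine ⟨hasSum_kalikow hΔsum hlam,
    isProbabilityMeasure_stateLaw h.measurable_part hΓ hτ _, ?_, ?_⟩
  · filter_upwards [hv] with s hs hs'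
    have h1 := hs.steps_eq hs'.1
    omega
  · refine ⟨State.measurable_X, State.measurable_horizon hτ, hv.mono fun s hs => hs.pts_subset,
      ?_, ?_⟩
    · filter_upwards [hv] with s hs i
      refine lt_of_le_of_lt (lintegral_mono_set fun u hu => ?_) (hs.compensator_lt_top i)
      have hle : s.horizon Y tmax ≤ tmax :=
        (s.horizon_le_exitTime htmax).trans (exitTime_le htmax)
      exact ⟨⟨hu.1, hu.2.trans hle⟩, hu.2⟩
    · intro i a b ha _ A hA
      have hAm : MeasurableSet A :=
        history_le State.measurable_X (State.measurable_horizon hτ) A hA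
      rw [← lintegral_indicator hAm, ← lintegral_indicator hAm]
      exact h.lintegral_count_eq_lintegral_compensator le_rfl i ha b hA
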